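/- **Theorem 1.1.** Let $(B_1,g_{B_1})$ and $(B_2,g_{B_2})$ be (non-empty, smooth) semi-Riemannian manifolds of dimensions $n_1$ and $n_2$, let $\lambda\in\mathbb R$, and suppose that $B_2$ is Einstein with constant $\lambda$, i.e. $\mathrm{Ric}_{B_2}=\lambda g_{B_2}$. Let $f_1:B_1\to\mathbb R^+$ and $f_2:B_2\to\mathbb R^+$ be smooth positive functions, and put $f(x,y)=f_1(x)+f_2(y)$ on $B=B_1\times B_2$, which carries the product metric $g_B=g_{B_1}+g_{B_2}$. Let $d\ge 1$, let $F=\mathbb R^d$ with the flat metric $(g_F)_{ab}=-\delta_{ab}$, and let $M=(B_1\times B_2)\times_f F$ with the metric $g_M=g_{B_1}+g_{B_2}+f^2g_F$ (pullbacks by the projections are understood). Here $\mathrm{Ric}$ and $R$ denote Ricci tensors and scalar curvatures, $\mathrm{Hess}_i$ and $\Delta_i=\mathrm{tr}\,\mathrm{Hess}_i$ are the Hessian and the Laplacian of $(B_i,g_{B_i})$, and $|\nabla f|^2=g_B(\nabla f,\nabla f)$ with the gradient taken with respect to $g_B$. (a) $\mathrm{Ric}_M=\lambda g_M$ if and only if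 all of the following hold: $$\mathrm{Ric}_{B_1}-\tfrac{d}{f}\,\mathrm{Hess}_1(f_1)=\lambda g_{B_1},\qquad \mathrm{Hess}_2(f_2)=0,\qquad \mathrm{Ric}_{B_2}=\lambda g_{B_2},\qquad \mathrm{Ric}_F=0,$$ $$f\,\Delta_1f_1+(d-1)|\nabla f|^2+\lambda f^2=0,$$ where the equations involving $f$ are required at every point $(x,y)$ of $B_1\times B_2$. (b) $\mathrm{Ric}_B=\mathrm{Ric}_{B_1}+\mathrm{Ric}_{B_2}$, and if $\mathrm{Ric}_M=\lambda g_M$, then $\mathrm{Ric}_B=\lambda(g_{B_1}+g_{B_2})+\frac{d}{f}\,\mathrm{Hess}_1(f_1)$. (c) (Traced version.) Consider the system $$R_{B_1}f-d\,\Delta_1f_1=n_1\lambda f,\qquad \Delta_2f_2=0,\qquad R_{B_2}=\lambda n_2,\qquad R_F=0,\qquad f\,\Delta_1f_1+(d-1)|\nabla f|^2+\lambda f^2=0.$$ If $\mathrm{Ric}_M=\lambda g_M$, then both $R_M=\lambda(n_1+n_2+d)$ and this system hold. Conversely, the system implies $R_M=\lambda(n_1+n_2+d)$ (without assuming that $M$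 is Einstein). -/

import Mathlib

open scoped Manifold ContDiff

set_option maxSynthPendingDepth 3

noncomputable section

namespace SemiRiem

/-! ## Local calculus

`E` is a finite dimensional real vector space and `G : E → (E →L[ℝ] E →L[ℝ] ℝ)` is a field of
symmetric nondegenerate bilinear forms near a point of `E` (a metric read in a chart).  All formulas
are the classical coordinate formulas, written without choosing a basis. -/

section Local

variable {E : Type*} [NormedAddCommGroup E] [NormedSpace ℝ E]

/-- Cyclic permutation of the arguments of a trilinear map: `(v, w, u) ↦ T u v w`. -/
def rotate (T : E →L[ℝ] E →L[ℝ] E →L[ℝ] ℝ) : E →L[ℝ] E →L[ℝ] E →L[ℝ] ℝ :=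
  ((ContinuousLinearMap.flipₗᵢ ℝ E E ℝ).toContinuousLinearEquiv :
    (E →L[ℝ] E →L[ℝ] ℝ) →L[ℝ] (E →L[ℝ] E →L[ℝ] ℝ)).comp T.flip

lemma rotate_apply (T : E →L[ℝ] E →L[ℝ] E →L[ℝ] ℝ) (v w u : E) : rotate T v w u = T u v w := rfl

/-- From the derivative `T u v w = ∂_u G(v, w)` of a metric, the Christoffel symbols of the first
kind `(v, w, u) ↦ (∂_v G(w, u) + ∂_w G(v, u) - ∂_u G(v, w)) / 2`. -/
def firstKind (T : E →L[ℝ] E →L[ℝ] E →L[ℝ] ℝ) : E →L[ℝ] E →L[ℝ] E →L[ℝ] ℝ :=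
  (2⁻¹ : ℝ) • (T + T.flip - rotate T)

lemma firstKind_apply (T : E →L[ℝ] E →L[ℝ] E →L[ℝ] ℝ) (v w u : E) :
    firstKind T v w u = 2⁻¹ * (T v w u + T w v u - T u v w) := by
  simp [firstKind, rotate_apply]

/-- The Christoffel symbols (of the second kind) of `G` at `x`, as a bilinear map:
`christoffel G x v w` is the vector `Γ_x(v, w)` with
`G_x(Γ_x(v, w), u) = (∂_v G(w, u) + ∂_w G(v, u) - ∂_u G(v, w)) / 2` for all `u`. Here
`(G x).inverse` is the index-raising map, the inverse of `v ↦ G_x(v, ·)`. -/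
def christoffel (G : E → E →L[ℝ] E →L[ℝ] ℝ) (x : E) : E →L[ℝ] E →L[ℝ] E :=
  (ContinuousLinearMap.compL ℝ E (E →L[ℝ] ℝ) E (G x).inverse).comp (firstKind (fderiv ℝ G x))

lemma christoffel_apply (G : E → E →L[ℝ] E →L[ℝ] ℝ) (x v w : E) :
    christoffel G x v w = (G x).inverse (firstKind (fderiv ℝ G x) v w) := rfl

/-- For fixed `v, w`, the endomorphism `u ↦ R(u, v) w`, where `R` is the curvature tensor at `x`:
`R(u, v) w = (∂_u Γ)(v, w) - (∂_v Γ)(u, w) + Γ(u, Γ(v, w)) - Γ(v, Γ(u, w))`. -/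
def curvatureEnd (G : E → E →L[ℝ] E →L[ℝ] ℝ) (x v w : E) : E →L[ℝ] E :=
  ((fderiv ℝ (christoffel G) x).flip v).flip w - (fderiv ℝ (christoffel G) x v).flip w
    + (christoffel G x).flip (christoffel G x v w)
    - (christoffel G x v).comp ((christoffel G x).flip w)

lemma curvatureEnd_apply (G : E → E →L[ℝ] E →L[ℝ] ℝ) (x u v w : E) :
    curvatureEnd G x v w u =
      fderiv ℝ (christoffel G) x u v w - fderiv ℝ (christoffel G) x v u w
      + christoffel G x u (christoffel G x v w) - christoffel G x v (christoffel G x u w) := by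
  simp [curvatureEnd]

/-- The Ricci tensor of `G` at `x`: `Ric(v, w) = tr (u ↦ R(u, v) w)`. -/
def localRicci [FiniteDimensional ℝ E] (G : E → E →L[ℝ] E →L[ℝ] ℝ) (x : E) :
    E →L[ℝ] E →L[ℝ] ℝ :=
  LinearMap.toContinuousBilinearMap <|
    LinearMap.mk₂ ℝ (fun v w => LinearMap.trace ℝ E (curvatureEnd G x v w).toLinearMap)
      (fun v v' w => by
        rw [← map_add]; congr 1; ext u
        simp only [curvatureEnd_apply, ContinuousLinearMap.coe_coe,
          LinearMap.add_apply, add_apply, map_add]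
        abel)
      (fun c v w => by
        rw [← map_smul]; congr 1; ext u
        simp only [curvatureEnd_apply, ContinuousLinearMap.coe_coe,
          LinearMap.smul_apply, smul_apply, map_smul, smul_add, smul_sub])
      (fun v w w' => by
        rw [← map_add]; congr 1; ext u
        simp only [curvatureEnd_apply, ContinuousLinearMap.coe_coe,
          LinearMap.add_apply, map_add]
        abel)
      (fun c v w => by
        rw [← map_smul]; congr 1; ext u
        simp only [curvatureEnd_apply, ContinuousLinearMap.coe_coe,
          LinearMap.smul_apply, map_smul,
          smul_add, smul_sub])

lemma localRicci_apply [FiniteDimensional ℝ E] (G : E → E →L[ℝ] E →L[ℝ] ℝ) (x v w : E) :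
    localRicci G x v w = LinearMap.trace ℝ E (curvatureEnd G x v w).toLinearMap := rfl

/-- The Hessian of a function at `x`: `Hess h (v, w) = ∂²h(v, w) - ∂h(Γ(v, w))`. -/
def localHessian (G : E → E →L[ℝ] E →L[ℝ] ℝ) (h : E → ℝ) (x : E) : E →L[ℝ] E →L[ℝ] ℝ :=
  fderiv ℝ (fderiv ℝ h) x -
    (ContinuousLinearMap.compL ℝ E E ℝ (fderiv ℝ h x)).comp (christoffel G x)

lemma localHessian_apply (G : E → E →L[ℝ] E →L[ℝ] ℝ) (h : E → ℝ) (x v w : E) :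
    localHessian G h x v w =
      fderiv ℝ (fderiv ℝ h) x v w - fderiv ℝ h x (christoffel G x v w) := rfl

/-- The trace of a bilinear form `b` with respect to a nondegenerate form `g`, i.e. the trace of the
endomorphism `A` with `g(A v, w) = b(v, w)`; in coordinates, `∑ g^{ij} b_{ij}`. -/
def traceWith (g b : E →L[ℝ] E →L[ℝ] ℝ) : ℝ :=
  LinearMap.trace ℝ E (g.inverse.comp b).toLinearMap

/-- The vector dual to a covector `α`: `g(raise g α, v) = α(v)` for all `v`. -/
def raise (g : E →L[ℝ] E →L[ℝ] ℝ) (α : E →L[ℝ] ℝ) : E := g.inverse α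

/-- The pullback of a bilinear form by a linear map: `(v, w) ↦ b(A v, A w)`. -/
def pullbackForm {E' : Type*} [NormedAddCommGroup E'] [NormedSpace ℝ E']
    (b : E' →L[ℝ] E' →L[ℝ] ℝ) (A : E →L[ℝ] E') : E →L[ℝ] E →L[ℝ] ℝ :=
  b.bilinearComp A A

end Local

/-! ## Manifolds

`TangentSpace I p` is by definition the model space `E`, a vector being represented by its
components in the preferred chart `extChartAt I p` at `p`.  Tensors at `p` are therefore computed
by the local formulas in this chart.  All models below are without boundary. -/

section Manifold

variable {E : Type*} [NormedAddCommGroup E] [NormedSpace ℝ E]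
  {H : Type*} [TopologicalSpace H] (I : ModelWithCorners ℝ E H)
  {E' : Type*} [NormedAddCommGroup E'] [NormedSpace ℝ E']
  {H' : Type*} [TopologicalSpace H'] (I' : ModelWithCorners ℝ E' H')

/-- Covariant tensor fields of rank two on `M` (no regularity is built in). -/
abbrev Tensor₂ (M : Type*) [TopologicalSpace M] [ChartedSpace H M] :=
  ∀ p : M, TangentSpace I p →L[ℝ] TangentSpace I p →L[ℝ] ℝ

variable {M : Type*} [TopologicalSpace M] [ChartedSpace H M]
  {M' : Type*} [TopologicalSpace M'] [ChartedSpace H' M']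

/-- The pullback `φ^* b`, that is `(φ^* b)(v, w) = b(dφ v, dφ w)`. -/
def pullback (φ : M → M') (b : Tensor₂ I' M') : Tensor₂ I M := fun p =>
  pullbackForm (E := E) (E' := E') (b (φ p)) (mfderiv I I' φ p)

/-- The components of a tensor field in the preferred chart at `p`, a function on `E` (meaningful on
the target of the chart). -/
def inChart (b : Tensor₂ I M) (p : M) : E → E →L[ℝ] E →L[ℝ] ℝ :=
  pullback 𝓘(ℝ, E) I (extChartAt I p).symm b

/-- `g` is a semi-Riemannian metric: symmetric, nondegenerate, with smooth components in charts.
(The signature is not restricted; it is automatically constant on connected components.) -/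
structure IsSemiRiemannian (g : Tensor₂ I M) : Prop where
  symm : ∀ (p : M) (v w : TangentSpace I p), g p v w = g p w v
  nondegenerate : ∀ (p : M) (v : TangentSpace I p), (∀ w : TangentSpace I p, g p v w = 0) → v = 0
  smooth : ∀ p : M, ContDiffOn ℝ ∞ (inChart I g p) (extChartAt I p).target

/-- The Ricci tensor of the metric `g`. -/
def ricci [FiniteDimensional ℝ E] (g : Tensor₂ I M) : Tensor₂ I M := fun p =>
  localRicci (E := E) (inChart I g p) (extChartAt I p p)

/-- The Hessian of the function `h` with respect to the metric `g`. -/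
def hessian (g : Tensor₂ I M) (h : M → ℝ) : Tensor₂ I M := fun p =>
  localHessian (E := E) (inChart I g p) (h ∘ (extChartAt I p).symm) (extChartAt I p p)

/-- The trace `tr_g b` of a tensor field. -/
def metricTrace (g b : Tensor₂ I M) (p : M) : ℝ :=
  traceWith (E := E) (g p) (b p)

/-- The scalar curvature, `tr_g Ric`. -/
def scalarCurvature [FiniteDimensional ℝ E] (g : Tensor₂ I M) : M → ℝ :=
  metricTrace I g (ricci I g)

/-- The Laplacian, `tr_g Hess`. -/
def laplacian (g : Tensor₂ I M) (h : M → ℝ) : M → ℝ :=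
  metricTrace I g (hessian I g h)

/-- The gradient: `g(∇h, v) = dh(v)` for all `v`. -/
def gradient (g : Tensor₂ I M) (h : M → ℝ) (p : M) : TangentSpace I p :=
  raise (E := E) (g p) (mfderiv I 𝓘(ℝ, ℝ) h p)

/-- `|∇h|² = g(∇h, ∇h)` (which may be negative if `g` is indefinite). -/
def gradNormSq (g : Tensor₂ I M) (h : M → ℝ) (p : M) : ℝ :=
  g p (gradient I g h p) (gradient I g h p)

/-- `g` is an Einstein metric with constant `lam`: `Ric = lam • g`. -/
def IsEinstein [FiniteDimensional ℝ E] (g : Tensor₂ I M) (lam : ℝ) : Prop :=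
  ricci I g = lam • g

/-- The metric `τ^* g + f² σ^* g'` of the warped product `M ×_f M'`, where `τ`, `σ` are the
projections of `M × M'` to the base `M` and the fiber `M'`. -/
def warpedMetric (g : Tensor₂ I M) (g' : Tensor₂ I' M') (f : M → ℝ) :
    Tensor₂ (I.prod I') (M × M') := fun p =>
  pullback (I.prod I') I Prod.fst g p + (f p.1) ^ 2 • pullback (I.prod I') I' Prod.snd g' p

/-- The metric `τ₁^* g + τ₂^* g'` of the semi-Riemannian product `M × M'`. -/
def productMetric (g : Tensor₂ I M) (g' : Tensor₂ I' M') : Tensor₂ (I.prod I') (M × M') :=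
  pullback (I.prod I') I Prod.fst g + pullback (I.prod I') I' Prod.snd g'

end Manifold

/-- The flat metric `g_{ab} = -δ_{ab}` on `ℝ^d`. -/
def negEuclidean (d : ℕ) :
    Tensor₂ 𝓘(ℝ, EuclideanSpace ℝ (Fin d)) (EuclideanSpace ℝ (Fin d)) :=
  fun _ => -(innerSL ℝ : EuclideanSpace ℝ (Fin d) →L[ℝ] EuclideanSpace ℝ (Fin d) →L[ℝ] ℝ)

/-! ## The special sequential warped product `M = (B₁ × B₂) ×_{f₁ + f₂} ℝ^d` -/

section Special

variable {E₁ : Type*} [NormedAddCommGroup E₁] [NormedSpace ℝ E₁]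
  {H₁ : Type*} [TopologicalSpace H₁] (I₁ : ModelWithCorners ℝ E₁ H₁)
  {E₂ : Type*} [NormedAddCommGroup E₂] [NormedSpace ℝ E₂]
  {H₂ : Type*} [TopologicalSpace H₂] (I₂ : ModelWithCorners ℝ E₂ H₂)
  {B₁ : Type*} [TopologicalSpace B₁] [ChartedSpace H₁ B₁]
  {B₂ : Type*} [TopologicalSpace B₂] [ChartedSpace H₂ B₂]

/-- The model with corners of `(B₁ × B₂) × ℝ^d`. -/
abbrev totalModel (d : ℕ) := (I₁.prod I₂).prod 𝓘(ℝ, EuclideanSpace ℝ (Fin d))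

/-- The warping function `f(x, y) = f₁(x) + f₂(y)`. -/
def warping (f₁ : B₁ → ℝ) (f₂ : B₂ → ℝ) : B₁ × B₂ → ℝ := fun b => f₁ b.1 + f₂ b.2

/-- The metric `g_M = (g₁ + g₂) + (f₁ + f₂)² g_F` on `M = (B₁ × B₂) × ℝ^d`, `g_F = -δ`. -/
def totalMetric (g₁ : Tensor₂ I₁ B₁) (g₂ : Tensor₂ I₂ B₂) (f₁ : B₁ → ℝ) (f₂ : B₂ → ℝ) (d : ℕ) :
    Tensor₂ (totalModel I₁ I₂ d) ((B₁ × B₂) × EuclideanSpace ℝ (Fin d)) :=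
  warpedMetric (I₁.prod I₂) 𝓘(ℝ, EuclideanSpace ℝ (Fin d))
    (productMetric I₁ I₂ g₁ g₂) (negEuclidean d) (warping f₁ f₂)

/-- The scalar equation `f Δ₁f₁ + (d - 1) |∇f|² + λ f² = 0` on `B₁ × B₂`, where `|∇f|²` is taken
with respect to the product metric. -/
def FiberEquation (g₁ : Tensor₂ I₁ B₁) (g₂ : Tensor₂ I₂ B₂) (f₁ : B₁ → ℝ) (f₂ : B₂ → ℝ) (d : ℕ)
    (lam : ℝ) : Prop :=
  ∀ b : B₁ × B₂, warping f₁ f₂ b * laplacian I₁ g₁ f₁ b.1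
    + ((d : ℝ) - 1) * gradNormSq (I₁.prod I₂) (productMetric I₁ I₂ g₁ g₂) (warping f₁ f₂) b
    + lam * warping f₁ f₂ b ^ 2 = 0

/-- The traced (scalar curvature) system. -/
def TracedSystem [FiniteDimensional ℝ E₁] [FiniteDimensional ℝ E₂]
    (g₁ : Tensor₂ I₁ B₁) (g₂ : Tensor₂ I₂ B₂) (f₁ : B₁ → ℝ) (f₂ : B₂ → ℝ) (d : ℕ)
    (lam : ℝ) : Prop :=
  (∀ b : B₁ × B₂, scalarCurvature I₁ g₁ b.1 * warping f₁ f₂ b - laplacian I₁ g₁ f₁ b.1 * (d : ℝ)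
    = (Module.finrank ℝ E₁ : ℝ) * warping f₁ f₂ b * lam) ∧
  (∀ y, laplacian I₂ g₂ f₂ y = 0) ∧
  (∀ y, scalarCurvature I₂ g₂ y = lam * (Module.finrank ℝ E₂ : ℝ)) ∧
  (∀ z, scalarCurvature 𝓘(ℝ, EuclideanSpace ℝ (Fin d)) (negEuclidean d) z = 0) ∧
  FiberEquation I₁ I₂ g₁ g₂ f₁ f₂ d lam

end Special

end SemiRiem

end

/-!
A warped product `M = B ×_f F` whose fibre carries a constant form `h` has a Ricci tensor without
mixed components: with `d = dim F`, it is `Ric_B - (d / f) Hess f` along the base and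
`-(f Δf + (d - 1) |∇f|²) h` along the fibre (`ricci_warpedMetric_negEuclidean`). When
`B = B₁ × B₂` is a semi-Riemannian product and `f = f₁ + f₂`, the tensors `Ric_B` and `Hess f` split
into blocks over the two factors (`ricci_productMetric`, `hessian_productMetric`). Hence the
equation `Ric_M = λ g_M` is a system of three block equations (`isEinstein_totalMetric_iff`). Since
`B₂` is Einstein with the same constant and `d ≠ 0`, the block over `B₂` says exactly that
`Hess₂ f₂ = 0`. Tracing the three blocks gives the scalar curvature of `M`
(`scalarCurvature_totalMetric`), from which the traced statements follow by algebra.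

All tensors are computed in charts. A product chart turns the metrics into `localProduct` and
`localWarped`, whose Christoffel symbols have closed forms. The Ricci tensor is the trace of
`u ↦ R(u, v) w`, so only the two diagonal blocks of this endomorphism are needed
(`trace_prod_eq`, `curvatureEnd_base`, `curvatureEnd_fiber`). The Laplacian enters through the
identity `∇_u (grad f) = (Hess f (u, ·))^♯` (`IsMetricOn.covariantDeriv_gradient`).
-/

noncomputable section

namespace SemiRiem

/-! ### Bilinear forms and traces -/

section Algebra

variable {E : Type*} [NormedAddCommGroup E] [NormedSpace ℝ E]
  {F : Type*} [NormedAddCommGroup F] [NormedSpace ℝ F]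

lemma pullbackForm_apply (b : F →L[ℝ] F →L[ℝ] ℝ) (A : E →L[ℝ] F) (v w : E) :
    pullbackForm b A v w = b (A v) (A w) := rfl

/-- The orthogonal sum of two bilinear forms: `((v, a), (w, b)) ↦ g(v, w) + h(a, b)`. -/
def formProd (g : E →L[ℝ] E →L[ℝ] ℝ) (h : F →L[ℝ] F →L[ℝ] ℝ) :
    (E × F) →L[ℝ] (E × F) →L[ℝ] ℝ :=
  pullbackForm g (ContinuousLinearMap.fst ℝ E F) + pullbackForm h (ContinuousLinearMap.snd ℝ E F)

lemma formProd_apply (g : E →L[ℝ] E →L[ℝ] ℝ) (h : F →L[ℝ] F →L[ℝ] ℝ) (v w : E × F) :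
    formProd g h v w = g v.1 w.1 + h v.2 w.2 := rfl

lemma formProd_inj {g g' : E →L[ℝ] E →L[ℝ] ℝ} {h h' : F →L[ℝ] F →L[ℝ] ℝ} :
    formProd g h = formProd g' h' ↔ g = g' ∧ h = h' := by
  refine ⟨fun H => ⟨?_, ?_⟩, fun ⟨h₁, h₂⟩ => by rw [h₁, h₂]⟩
  · ext v w
    simpa [formProd_apply] using DFunLike.congr_fun (DFunLike.congr_fun H (v, (0 : F))) (w, (0 : F))
  · ext v w
    simpa [formProd_apply] using DFunLike.congr_fun (DFunLike.congr_fun H ((0 : E), v)) ((0 : E), w)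

lemma smul_formProd (c : ℝ) (g : E →L[ℝ] E →L[ℝ] ℝ) (h : F →L[ℝ] F →L[ℝ] ℝ) :
    c • formProd g h = formProd (c • g) (c • h) := by
  ext v w <;> simp [formProd_apply]

lemma formProd_sub_smul_formProd (c : ℝ) (g g' : E →L[ℝ] E →L[ℝ] ℝ) (h h' : F →L[ℝ] F →L[ℝ] ℝ) :
    formProd g h - c • formProd g' h' = formProd (g - c • g') (h - c • h') := by
  ext v w <;> simp [formProd_apply]

lemma formProd_smul_add (c k : ℝ) (g b : E →L[ℝ] E →L[ℝ] ℝ) (h : F →L[ℝ] F →L[ℝ] ℝ) :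
    formProd (c • g + k • b) (c • h) =
      c • formProd g h + k • pullbackForm b (ContinuousLinearMap.fst ℝ E F) := by
  ext v w <;> simp [formProd_apply, pullbackForm_apply]

lemma smul_eq_smul_smul_iff {b : E →L[ℝ] E →L[ℝ] ℝ} (hb : b ≠ 0) {k c l : ℝ} :
    k • b = c • l • b ↔ k = c * l := by
  rw [smul_smul, (smul_left_injective ℝ hb).eq_iff]

/-- In finite dimension, a nondegenerate form identifies the space with its dual. -/
lemma isInvertible_of_nondegenerate [FiniteDimensional ℝ E] {g : E →L[ℝ] E →L[ℝ] ℝ}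
    (hg : ∀ v, (∀ w, g v w = 0) → v = 0) : g.IsInvertible := by
  have hinj : Function.Injective (g : E →ₗ[ℝ] (E →L[ℝ] ℝ)) := by
    rw [injective_iff_map_eq_zero]
    exact fun v hv => hg v fun w => DFunLike.congr_fun hv w
  have hrank : Module.finrank ℝ E = Module.finrank ℝ (E →L[ℝ] ℝ) := by
    rw [← (LinearMap.toContinuousLinearMap : (E →ₗ[ℝ] ℝ) ≃ₗ[ℝ] E →L[ℝ] ℝ).finrank_eq]
    exact (Subspace.dual_finrank_eq (K := ℝ) (V := E)).symm
  refine ⟨(LinearEquiv.ofInjectiveOfFinrankEq _ hinj hrank).toContinuousLinearEquiv, ?_⟩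
  ext v w
  rfl

lemma isInvertible_pullbackForm [FiniteDimensional ℝ E] {b : F →L[ℝ] F →L[ℝ] ℝ} {A : E →L[ℝ] F}
    (hb : b.IsInvertible) (hA : A.IsInvertible) : (pullbackForm b A).IsInvertible := by
  refine isInvertible_of_nondegenerate fun v hv => hA.injective (hb.injective ?_)
  rw [map_zero, map_zero]
  ext w
  obtain ⟨w, rfl⟩ := hA.surjective w
  exact hv w

/-- A vector `z` with `g(z, ·) = α` is the vector dual to `α`. -/
lemma eq_inverse_apply {g : E →L[ℝ] E →L[ℝ] ℝ} (hg : g.IsInvertible) {α : E →L[ℝ] ℝ} {z : E}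
    (h : ∀ u, g z u = α u) : g.inverse α = z := by
  rw [← hg.inverse_apply_self z]
  congr 1
  ext u
  exact (h u).symm

lemma formProd_isInvertible {g : E →L[ℝ] E →L[ℝ] ℝ} {h : F →L[ℝ] F →L[ℝ] ℝ}
    (hg : g.IsInvertible) (hh : h.IsInvertible) : (formProd g h).IsInvertible := by
  refine ContinuousLinearMap.IsInvertible.of_inverse
    (g := ((g.inverse.comp ((ContinuousLinearMap.compL ℝ E (E × F) ℝ).flip
        (ContinuousLinearMap.inl ℝ E F))).prod
      (h.inverse.comp ((ContinuousLinearMap.compL ℝ F (E × F) ℝ).flip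
        (ContinuousLinearMap.inr ℝ E F))))) ?_ ?_
  · have h₀ (α : (E × F) →L[ℝ] ℝ) : α (0, 0) = 0 := α.map_zero
    ext α <;> simp [formProd_apply, hg.self_apply_inverse, hh.self_apply_inverse, h₀]
  · refine ContinuousLinearMap.ext fun v => Prod.ext ?_ ?_
    · exact eq_inverse_apply hg fun u => by simp [formProd_apply]
    · exact eq_inverse_apply hh fun u => by simp [formProd_apply]

lemma formProd_inverse_apply {g : E →L[ℝ] E →L[ℝ] ℝ} {h : F →L[ℝ] F →L[ℝ] ℝ}
    (hg : g.IsInvertible) (hh : h.IsInvertible) (α : (E × F) →L[ℝ] ℝ) :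
    (formProd g h).inverse α = (g.inverse (α.comp (ContinuousLinearMap.inl ℝ E F)),
      h.inverse (α.comp (ContinuousLinearMap.inr ℝ E F))) := by
  refine eq_inverse_apply (formProd_isInvertible hg hh) fun u => ?_
  change g (g.inverse _) u.1 + h (h.inverse _) u.2 = α u
  rw [hg.self_apply_inverse, hh.self_apply_inverse,
    ContinuousLinearMap.comp_apply, ContinuousLinearMap.comp_apply, ← map_add]
  simp

/-- The trace of an endomorphism of a product is the sum of the traces of its diagonal blocks. -/
lemma trace_prod_eq [FiniteDimensional ℝ E] [FiniteDimensional ℝ F]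
    (A : (E × F) →ₗ[ℝ] (E × F)) :
    LinearMap.trace ℝ (E × F) A =
      LinearMap.trace ℝ E (LinearMap.fst ℝ E F ∘ₗ A ∘ₗ LinearMap.inl ℝ E F) +
      LinearMap.trace ℝ F (LinearMap.snd ℝ E F ∘ₗ A ∘ₗ LinearMap.inr ℝ E F) := by
  rw [LinearMap.trace_comp_comm' _ (LinearMap.fst ℝ E F), LinearMap.trace_comp_comm' _
    (LinearMap.snd ℝ E F), ← map_add]
  have h₀ : A (0, 0) = 0 := A.map_zero
  congr 1
  ext v <;> simp [h₀]

lemma traceWith_formProd [FiniteDimensional ℝ E] [FiniteDimensional ℝ F]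
    {g b : E →L[ℝ] E →L[ℝ] ℝ} {h k : F →L[ℝ] F →L[ℝ] ℝ}
    (hg : g.IsInvertible) (hh : h.IsInvertible) :
    traceWith (formProd g h) (formProd b k) = traceWith g b + traceWith h k := by
  rw [traceWith, trace_prod_eq, traceWith, traceWith]
  congr 2
  · ext v
    simp only [LinearMap.comp_apply, ContinuousLinearMap.coe_coe, ContinuousLinearMap.comp_apply,
      formProd_inverse_apply hg hh, LinearMap.fst_apply]
    congr 1
    ext u
    simp [formProd_apply]
  · ext v
    simp only [LinearMap.comp_apply, ContinuousLinearMap.coe_coe, ContinuousLinearMap.comp_apply,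
      formProd_inverse_apply hg hh, LinearMap.snd_apply]
    congr 1
    ext u
    simp [formProd_apply]

lemma isInvertible_smul {g : E →L[ℝ] E →L[ℝ] ℝ} (hg : g.IsInvertible) {c : ℝ} (hc : c ≠ 0) :
    (c • g).IsInvertible := by
  refine ContinuousLinearMap.IsInvertible.of_inverse (g := c⁻¹ • g.inverse) ?_ ?_
  · ext α u
    simp [hc, hg.self_apply_inverse]
  · ext u
    simp [hc, hg.inverse_apply_self]

lemma traceWith_smul_self [FiniteDimensional ℝ E] {g : E →L[ℝ] E →L[ℝ] ℝ}
    (hg : g.IsInvertible) {c : ℝ} (hc : c ≠ 0) (k : ℝ) :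
    traceWith (c • g) (k • g) = k / c * Module.finrank ℝ E := by
  have h : ((c • g).inverse.comp (k • g)).toLinearMap = (k / c) • LinearMap.id := by
    ext v
    refine eq_inverse_apply (isInvertible_smul hg hc) fun u => ?_
    change c * g ((k / c) • v) u = k * g v u
    rw [map_smul, smul_apply, smul_eq_mul]
    field_simp
  rw [traceWith, h, map_smul, LinearMap.trace_id, smul_eq_mul]

lemma traceWith_self [FiniteDimensional ℝ E] {g : E →L[ℝ] E →L[ℝ] ℝ} (hg : g.IsInvertible) :
    traceWith g g = Module.finrank ℝ E := by
  simpa using traceWith_smul_self hg one_ne_zero 1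

lemma traceWith_zero (g : E →L[ℝ] E →L[ℝ] ℝ) : traceWith g 0 = 0 := by
  simp [traceWith]

lemma traceWith_smul [FiniteDimensional ℝ E] (g b : E →L[ℝ] E →L[ℝ] ℝ) (c : ℝ) :
    traceWith g (c • b) = c * traceWith g b := by
  simp [traceWith]

lemma traceWith_sub [FiniteDimensional ℝ E] (g b b' : E →L[ℝ] E →L[ℝ] ℝ) :
    traceWith g (b - b') = traceWith g b - traceWith g b' := by
  simp [traceWith, ContinuousLinearMap.comp_sub]

end Algebra

/-! ### Derivatives along a product -/

section Calculus

variable {E : Type*} [NormedAddCommGroup E] [NormedSpace ℝ E]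
  {F : Type*} [NormedAddCommGroup F] [NormedSpace ℝ F]

lemma fderiv_comp_fst {A : Type*} [NormedAddCommGroup A] [NormedSpace ℝ A] {φ : E → A}
    {p : E × F} (h : DifferentiableAt ℝ φ p.1) (u : E × F) :
    fderiv ℝ (fun q : E × F => φ q.1) p u = fderiv ℝ φ p.1 u.1 := by
  have := h.hasFDerivAt.comp p hasFDerivAt_fst
  rw [HasFDerivAt.fderiv (f := fun q : E × F => φ q.1) this]
  rfl

lemma fderiv_comp_snd {A : Type*} [NormedAddCommGroup A] [NormedSpace ℝ A] {φ : F → A}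
    {p : E × F} (h : DifferentiableAt ℝ φ p.2) (u : E × F) :
    fderiv ℝ (fun q : E × F => φ q.2) p u = fderiv ℝ φ p.2 u.2 := by
  have := h.hasFDerivAt.comp p hasFDerivAt_snd
  rw [HasFDerivAt.fderiv (f := fun q : E × F => φ q.2) this]
  rfl

lemma fderiv_clm_eval {D A : Type*} [NormedAddCommGroup D] [NormedSpace ℝ D]
    [NormedAddCommGroup A] [NormedSpace ℝ A] {φ : D → D →L[ℝ] A} {x : D}
    (h : DifferentiableAt ℝ φ x) (v w : D) :
    fderiv ℝ φ x v w = fderiv ℝ (fun y => φ y w) x v := by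
  rw [(h.hasFDerivAt.clm_apply (hasFDerivAt_const w x)).fderiv]
  simp

lemma fderiv_prodMk_apply {D A B : Type*} [NormedAddCommGroup D] [NormedSpace ℝ D]
    [NormedAddCommGroup A] [NormedSpace ℝ A] [NormedAddCommGroup B] [NormedSpace ℝ B]
    {φ : D → A} {ψ : D → B} {p : D} (hφ : DifferentiableAt ℝ φ p) (hψ : DifferentiableAt ℝ ψ p)
    (u : D) : fderiv ℝ (fun q => (φ q, ψ q)) p u = (fderiv ℝ φ p u, fderiv ℝ ψ p u) := by
  rw [hφ.fderiv_prodMk hψ]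
  rfl

lemma fderiv_add_prod {p : E × F} {f : E → ℝ} {k : F → ℝ} (hf : DifferentiableAt ℝ f p.1)
    (hk : DifferentiableAt ℝ k p.2) (u : E × F) :
    fderiv ℝ (fun q : E × F => f q.1 + k q.2) p u = fderiv ℝ f p.1 u.1 + fderiv ℝ k p.2 u.2 := by
  rw [← fderiv_comp_fst hf, ← fderiv_comp_snd hk]
  exact congrArg (fun L : (E × F) →L[ℝ] ℝ => L u)
    (fderiv_fun_add (hf.comp p differentiableAt_fst) (hk.comp p differentiableAt_snd))

end Calculus

/-! ### Metrics on open subsets of a vector space -/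

section LocalMetric

variable {E : Type*} [NormedAddCommGroup E] [NormedSpace ℝ E]
  {F : Type*} [NormedAddCommGroup F] [NormedSpace ℝ F]

/-- `G` is a semi-Riemannian metric on the open subset `U` of a vector space: a smooth field of
symmetric invertible forms. -/
structure IsMetricOn (G : E → E →L[ℝ] E →L[ℝ] ℝ) (U : Set E) : Prop where
  isOpen : IsOpen U
  smooth : ContDiffOn ℝ ∞ G U
  symm : ∀ x ∈ U, ∀ v w, G x v w = G x w v
  invertible : ∀ x ∈ U, (G x).IsInvertible

lemma fderiv_apply_apply {A : Type*} [NormedAddCommGroup A] [NormedSpace ℝ A]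
    {T : E → F →L[ℝ] F →L[ℝ] A} {x : E} (hT : DifferentiableAt ℝ T x) (u : E) (v w : F) :
    fderiv ℝ T x u v w = fderiv ℝ (fun y => T y v w) x u := by
  have h₁ : HasFDerivAt (fun y => T y v) _ x := hT.hasFDerivAt.clm_apply (hasFDerivAt_const v x)
  have h₂ : HasFDerivAt (fun y => T y v w) _ x := h₁.clm_apply (hasFDerivAt_const w x)
  rw [h₂.fderiv]
  simp

variable {G : E → E →L[ℝ] E →L[ℝ] ℝ} {U : Set E} {x : E}

lemma IsMetricOn.contDiffAt (hG : IsMetricOn G U) (hx : x ∈ U) : ContDiffAt ℝ ∞ G x :=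
  hG.smooth.contDiffAt (hG.isOpen.mem_nhds hx)

lemma IsMetricOn.differentiableAt (hG : IsMetricOn G U) (hx : x ∈ U) : DifferentiableAt ℝ G x :=
  (hG.contDiffAt hx).differentiableAt (by simp)

/-- The derivative of a metric in a fixed direction is symmetric. -/
lemma IsMetricOn.fderiv_symm (hG : IsMetricOn G U) (hx : x ∈ U) (u v w : E) :
    fderiv ℝ G x u v w = fderiv ℝ G x u w v := by
  rw [fderiv_apply_apply (hG.differentiableAt hx), fderiv_apply_apply (hG.differentiableAt hx)]
  have h : (fun y => G y v w) =ᶠ[nhds x] fun y => G y w v := by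
    filter_upwards [hG.isOpen.mem_nhds hx] with y hy using hG.symm y hy v w
  rw [h.fderiv_eq]

lemma IsMetricOn.apply_christoffel (hG : IsMetricOn G U) (hx : x ∈ U) (v w u : E) :
    G x (christoffel G x v w) u =
      2⁻¹ * (fderiv ℝ G x v w u + fderiv ℝ G x w v u - fderiv ℝ G x u v w) := by
  rw [christoffel_apply, (hG.invertible x hx).self_apply_inverse, firstKind_apply]

/-- The Koszul formula determines the Christoffel symbols, as the metric is nondegenerate. -/
lemma IsMetricOn.christoffel_eq (hG : IsMetricOn G U) (hx : x ∈ U) {v w z : E}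
    (h : ∀ u, G x z u =
      2⁻¹ * (fderiv ℝ G x v w u + fderiv ℝ G x w v u - fderiv ℝ G x u v w)) :
    christoffel G x v w = z := by
  rw [christoffel_apply]
  exact eq_inverse_apply (hG.invertible x hx) fun u => by rw [h, firstKind_apply]

lemma contDiffAt_fderiv {A : Type*} [NormedAddCommGroup A] [NormedSpace ℝ A] {f : E → A}
    (hf : ContDiffAt ℝ ∞ f x) : ContDiffAt ℝ ∞ (fderiv ℝ f) x :=
  hf.fderiv_right (by simp)

lemma differentiableAt_fderiv {A : Type*} [NormedAddCommGroup A] [NormedSpace ℝ A] {f : E → A}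
    (hf : ContDiffAt ℝ ∞ f x) : DifferentiableAt ℝ (fderiv ℝ f) x :=
  (contDiffAt_fderiv hf).differentiableAt (by simp)

lemma IsMetricOn.contDiffAt_inverse [CompleteSpace E] (hG : IsMetricOn G U) (hx : x ∈ U) :
    ContDiffAt ℝ ∞ (fun y => (G y).inverse) x :=
  (hG.invertible x hx).contDiffAt_map_inverse.comp x (hG.contDiffAt hx)

lemma contDiff_firstKind {n : WithTop ℕ∞} : ContDiff ℝ n (firstKind (E := E)) := by
  have h₁ : ContDiff ℝ n fun T : E →L[ℝ] E →L[ℝ] E →L[ℝ] ℝ => T.flip :=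
    (ContinuousLinearMap.flipₗᵢ ℝ E E (E →L[ℝ] ℝ)).contDiff
  have h₂ : ContDiff ℝ n (rotate (E := E)) := contDiff_const.clm_comp h₁
  have h₃ : ContDiff ℝ n fun T : E →L[ℝ] E →L[ℝ] E →L[ℝ] ℝ => T + T.flip - rotate T :=
    (contDiff_id.add h₁).sub h₂
  exact h₃.const_smul (2⁻¹ : ℝ)

lemma IsMetricOn.contDiffAt_christoffel [CompleteSpace E] (hG : IsMetricOn G U) (hx : x ∈ U) :
    ContDiffAt ℝ ∞ (christoffel G) x := by
  refine ContDiffAt.clm_comp ?_ ?_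
  · exact (ContinuousLinearMap.compL ℝ E (E →L[ℝ] ℝ) E).contDiff.contDiffAt.comp x
      (hG.contDiffAt_inverse hx)
  · exact contDiff_firstKind.contDiffAt.comp x (contDiffAt_fderiv (hG.contDiffAt hx))

lemma IsMetricOn.differentiableAt_christoffel [CompleteSpace E] (hG : IsMetricOn G U)
    (hx : x ∈ U) : DifferentiableAt ℝ (christoffel G) x :=
  (hG.contDiffAt_christoffel hx).differentiableAt (by simp)

lemma christoffel_congr {G' : E → E →L[ℝ] E →L[ℝ] ℝ} (h : G =ᶠ[nhds x] G') :
    christoffel G =ᶠ[nhds x] christoffel G' := by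
  filter_upwards [h, h.fderiv (𝕜 := ℝ)] with y h₁ h₂
  rw [christoffel, christoffel, h₁, h₂]

/-- The Ricci tensor at a point depends only on the germ of the metric there. -/
lemma localRicci_congr [FiniteDimensional ℝ E] {G' : E → E →L[ℝ] E →L[ℝ] ℝ}
    (h : G =ᶠ[nhds x] G') : localRicci G x = localRicci G' x := by
  have hc := christoffel_congr h
  ext v w
  rw [localRicci_apply, localRicci_apply, curvatureEnd, curvatureEnd, hc.fderiv_eq, hc.eq_of_nhds]

lemma localHessian_congr {G' : E → E →L[ℝ] E →L[ℝ] ℝ} (h : G =ᶠ[nhds x] G') (f : E → ℝ) :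
    localHessian G f x = localHessian G' f x := by
  rw [localHessian, localHessian, (christoffel_congr h).eq_of_nhds]

lemma localRicci_const [FiniteDimensional ℝ E] (g : E →L[ℝ] E →L[ℝ] ℝ) :
    localRicci (fun _ => g) x = 0 := by
  have h : christoffel (fun _ : E => g) = 0 := by
    ext y v w
    simp [christoffel_apply, firstKind, rotate]
  ext v w
  rw [localRicci_apply, curvatureEnd, h]
  simp

/-- The curvature endomorphism in terms of the derivatives of the vectors `Γ(v, w)`, for fixed `v`
and `w`. -/
lemma IsMetricOn.curvatureEnd_apply [CompleteSpace E] (hG : IsMetricOn G U) (hx : x ∈ U)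
    (u v w : E) :
    curvatureEnd G x v w u =
      fderiv ℝ (fun y => christoffel G y v w) x u - fderiv ℝ (fun y => christoffel G y u w) x v
      + christoffel G x u (christoffel G x v w) - christoffel G x v (christoffel G x u w) := by
  rw [SemiRiem.curvatureEnd_apply, fderiv_apply_apply (hG.differentiableAt_christoffel hx),
    fderiv_apply_apply (hG.differentiableAt_christoffel hx)]

lemma IsMetricOn.differentiableAt_christoffel_apply [CompleteSpace E] (hG : IsMetricOn G U)
    (hx : x ∈ U) (v w : E) : DifferentiableAt ℝ (fun y => christoffel G y v w) x :=
  ((hG.differentiableAt_christoffel hx).clm_apply (differentiableAt_const v)).clm_apply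
    (differentiableAt_const w)

/-- The gradient of `f`, a vector field on an open set carrying the metric `G`. -/
def localGradient (G : E → E →L[ℝ] E →L[ℝ] ℝ) (f : E → ℝ) (x : E) : E :=
  raise (G x) (fderiv ℝ f x)

lemma IsMetricOn.apply_localGradient {f : E → ℝ} (hG : IsMetricOn G U) (hx : x ∈ U) (v : E) :
    G x (localGradient G f x) v = fderiv ℝ f x v := by
  rw [localGradient, raise, (hG.invertible x hx).self_apply_inverse]

lemma IsMetricOn.contDiffAt_localGradient [CompleteSpace E] {f : E → ℝ} (hG : IsMetricOn G U)
    (hx : x ∈ U) (hf : ContDiffAt ℝ ∞ f x) : ContDiffAt ℝ ∞ (localGradient G f) x :=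
  (hG.contDiffAt_inverse hx).clm_apply (contDiffAt_fderiv hf)

/-- `∇_u (grad f)` is the vector dual to `Hess f (u, ·)`. -/
lemma IsMetricOn.covariantDeriv_gradient [CompleteSpace E] (hG : IsMetricOn G U) (hx : x ∈ U)
    {f : E → ℝ} (hf : ContDiffAt ℝ ∞ f x) (u : E) :
    fderiv ℝ (localGradient G f) x u
      + christoffel G x u (localGradient G f x) =
    (G x).inverse (localHessian G f x u) := by
  have hN : DifferentiableAt ℝ (localGradient G f) x :=
    (hG.contDiffAt_localGradient hx hf).differentiableAt (by simp)
  symm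
  refine eq_inverse_apply (hG.invertible x hx) fun w => ?_
  set N := localGradient G f x
  -- the derivative of the identity `G(grad f, w) = df(w)` in the direction `u`
  have hid : (fun y => G y (localGradient G f y) w) =ᶠ[nhds x] fun y => fderiv ℝ f y w := by
    filter_upwards [hG.isOpen.mem_nhds hx] with y hy
    rw [hG.apply_localGradient hy]
  have hder := congrArg (fun L : E →L[ℝ] ℝ => L u) hid.fderiv_eq
  have h₁ : HasFDerivAt (fun y => G y (localGradient G f y) w) _ x :=
    ((hG.differentiableAt hx).hasFDerivAt.clm_apply hN.hasFDerivAt).clm_apply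
      (hasFDerivAt_const w x)
  have h₂ : HasFDerivAt (fun y => fderiv ℝ f y w) _ x :=
    (differentiableAt_fderiv hf).hasFDerivAt.clm_apply (hasFDerivAt_const w x)
  simp only [h₁.fderiv, h₂.fderiv] at hder
  simp at hder
  have hdf : fderiv ℝ f x (christoffel G x u w) = G x (christoffel G x u w) N := by
    rw [hG.symm x hx, hG.apply_localGradient hx]
  rw [localHessian_apply, hdf, map_add, add_apply, hG.apply_christoffel hx,
    hG.apply_christoffel hx, ← hder, hG.fderiv_symm hx N u w, hG.fderiv_symm hx u w N,
    hG.fderiv_symm hx w u N, hG.fderiv_symm hx N w u]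
  ring

end LocalMetric

/-! ### Product metrics on open sets -/

section LocalProduct

variable {E : Type*} [NormedAddCommGroup E] [NormedSpace ℝ E] [FiniteDimensional ℝ E]
  {F : Type*} [NormedAddCommGroup F] [NormedSpace ℝ F] [FiniteDimensional ℝ F]

/-- Pulling back forms by a fixed linear map, as a continuous linear map. -/
def pullbackFormL (A : E →L[ℝ] F) : (F →L[ℝ] F →L[ℝ] ℝ) →L[ℝ] (E →L[ℝ] E →L[ℝ] ℝ) :=
  LinearMap.toContinuousLinearMap
    { toFun := fun b => pullbackForm b A
      map_add' := fun _ _ => rfl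
      map_smul' := fun _ _ => rfl }

lemma contDiffAt_formProd {D : Type*} [NormedAddCommGroup D] [NormedSpace ℝ D]
    {A : D → E →L[ℝ] E →L[ℝ] ℝ} {B : D → F →L[ℝ] F →L[ℝ] ℝ} {p : D} {n : WithTop ℕ∞}
    (hA : ContDiffAt ℝ n A p) (hB : ContDiffAt ℝ n B p) :
    ContDiffAt ℝ n (fun q => formProd (A q) (B q)) p :=
  ((pullbackFormL (ContinuousLinearMap.fst ℝ E F)).contDiff.contDiffAt.comp p hA).add
    ((pullbackFormL (ContinuousLinearMap.snd ℝ E F)).contDiff.contDiffAt.comp p hB)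

lemma fderiv_formProd {D : Type*} [NormedAddCommGroup D] [NormedSpace ℝ D]
    {A : D → E →L[ℝ] E →L[ℝ] ℝ} {B : D → F →L[ℝ] F →L[ℝ] ℝ} {p : D}
    (hA : DifferentiableAt ℝ A p) (hB : DifferentiableAt ℝ B p) (u : D) :
    fderiv ℝ (fun q => formProd (A q) (B q)) p u =
      formProd (fderiv ℝ A p u) (fderiv ℝ B p u) := by
  have h : HasFDerivAt (fun q => formProd (A q) (B q)) _ p :=
    ((pullbackFormL (ContinuousLinearMap.fst ℝ E F)).hasFDerivAt.comp p hA.hasFDerivAt).add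
      ((pullbackFormL (ContinuousLinearMap.snd ℝ E F)).hasFDerivAt.comp p hB.hasFDerivAt)
  rw [h.fderiv]
  rfl

/-- The product of two metrics on open sets. -/
def localProduct (G : E → E →L[ℝ] E →L[ℝ] ℝ) (K : F → F →L[ℝ] F →L[ℝ] ℝ) :
    E × F → (E × F) →L[ℝ] (E × F) →L[ℝ] ℝ :=
  fun p => formProd (G p.1) (K p.2)

variable {G : E → E →L[ℝ] E →L[ℝ] ℝ} {U : Set E} {K : F → F →L[ℝ] F →L[ℝ] ℝ} {V : Set F}
  {p : E × F}

lemma IsMetricOn.localProduct (hG : IsMetricOn G U) (hK : IsMetricOn K V) :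
    IsMetricOn (localProduct G K) (U ×ˢ V) where
  isOpen := hG.isOpen.prod hK.isOpen
  smooth := fun p hp => (contDiffAt_formProd ((hG.contDiffAt hp.1).comp p contDiffAt_fst)
    ((hK.contDiffAt hp.2).comp p contDiffAt_snd)).contDiffWithinAt
  symm := fun p hp v w => by
    simp only [SemiRiem.localProduct, formProd_apply, hG.symm p.1 hp.1 v.1, hK.symm p.2 hp.2 v.2]
  invertible := fun p hp => formProd_isInvertible (hG.invertible _ hp.1) (hK.invertible _ hp.2)

lemma fderiv_localProduct (hG : IsMetricOn G U) (hK : IsMetricOn K V) (hp : p ∈ U ×ˢ V)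
    (u v w : E × F) :
    fderiv ℝ (localProduct G K) p u v w =
      fderiv ℝ G p.1 u.1 v.1 w.1 + fderiv ℝ K p.2 u.2 v.2 w.2 := by
  have h₁ := hG.differentiableAt hp.1
  have h₂ := hK.differentiableAt hp.2
  have := fderiv_formProd (h₁.comp p differentiableAt_fst) (h₂.comp p differentiableAt_snd) u
  rw [← fderiv_comp_fst h₁, ← fderiv_comp_snd h₂]
  exact congrArg (fun L : (E × F) →L[ℝ] (E × F) →L[ℝ] ℝ => L v w) this

lemma christoffel_localProduct (hG : IsMetricOn G U) (hK : IsMetricOn K V) (hp : p ∈ U ×ˢ V)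
    (v w : E × F) :
    christoffel (localProduct G K) p v w =
      (christoffel G p.1 v.1 w.1, christoffel K p.2 v.2 w.2) := by
  refine (hG.localProduct hK).christoffel_eq hp fun u => ?_
  rw [localProduct, formProd_apply, hG.apply_christoffel hp.1, hK.apply_christoffel hp.2]
  simp only [fderiv_localProduct hG hK hp]
  ring

lemma fderiv_christoffel_localProduct (hG : IsMetricOn G U) (hK : IsMetricOn K V)
    (hp : p ∈ U ×ˢ V) (u v w : E × F) :
    fderiv ℝ (fun q => christoffel (localProduct G K) q v w) p u =
      (fderiv ℝ (fun y => christoffel G y v.1 w.1) p.1 u.1,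
        fderiv ℝ (fun z => christoffel K z v.2 w.2) p.2 u.2) := by
  have h : (fun q => christoffel (localProduct G K) q v w) =ᶠ[nhds p]
      fun q => (christoffel G q.1 v.1 w.1, christoffel K q.2 v.2 w.2) := by
    filter_upwards [(hG.isOpen.prod hK.isOpen).mem_nhds hp] with q hq
    exact christoffel_localProduct hG hK hq v w
  have h₁ := hG.differentiableAt_christoffel_apply hp.1 v.1 w.1
  have h₂ := hK.differentiableAt_christoffel_apply hp.2 v.2 w.2
  rw [h.fderiv_eq, ← fderiv_comp_fst h₁, ← fderiv_comp_snd h₂]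
  exact fderiv_prodMk_apply (h₁.comp p differentiableAt_fst) (h₂.comp p differentiableAt_snd) u

lemma curvatureEnd_localProduct (hG : IsMetricOn G U) (hK : IsMetricOn K V)
    (hp : p ∈ U ×ˢ V) (u v w : E × F) :
    curvatureEnd (localProduct G K) p v w u =
      (curvatureEnd G p.1 v.1 w.1 u.1, curvatureEnd K p.2 v.2 w.2 u.2) := by
  rw [(hG.localProduct hK).curvatureEnd_apply hp, hG.curvatureEnd_apply hp.1,
    hK.curvatureEnd_apply hp.2]
  simp only [fderiv_christoffel_localProduct hG hK hp, christoffel_localProduct hG hK hp]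
  rfl

lemma localRicci_localProduct (hG : IsMetricOn G U) (hK : IsMetricOn K V) (hp : p ∈ U ×ˢ V) :
    localRicci (localProduct G K) p = formProd (localRicci G p.1) (localRicci K p.2) := by
  refine ContinuousLinearMap.ext fun v => ContinuousLinearMap.ext fun w => ?_
  rw [formProd_apply, localRicci_apply, localRicci_apply, localRicci_apply, trace_prod_eq]
  congr 2
  · ext u
    exact congrArg Prod.fst (curvatureEnd_localProduct hG hK hp (u, 0) v w)
  · ext u
    exact congrArg Prod.snd (curvatureEnd_localProduct hG hK hp (0, u) v w)

lemma localHessian_localProduct (hG : IsMetricOn G U) (hK : IsMetricOn K V) (hp : p ∈ U ×ˢ V)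
    {f : E → ℝ} {k : F → ℝ} (hf : ContDiffOn ℝ ∞ f U) (hk : ContDiffOn ℝ ∞ k V) :
    localHessian (localProduct G K) (fun q => f q.1 + k q.2) p =
      formProd (localHessian G f p.1) (localHessian K k p.2) := by
  have hf' (x) (hx : x ∈ U) : ContDiffAt ℝ ∞ f x := hf.contDiffAt (hG.isOpen.mem_nhds hx)
  have hk' (x) (hx : x ∈ V) : ContDiffAt ℝ ∞ k x := hk.contDiffAt (hK.isOpen.mem_nhds hx)
  have hd (q : E × F) (hq : q ∈ U ×ˢ V) (u : E × F) :
      fderiv ℝ (fun q : E × F => f q.1 + k q.2) q u =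
        fderiv ℝ f q.1 u.1 + fderiv ℝ k q.2 u.2 :=
    fderiv_add_prod ((hf' _ hq.1).differentiableAt (by simp))
      ((hk' _ hq.2).differentiableAt (by simp)) u
  have hs : ContDiffAt ℝ ∞ (fun q : E × F => f q.1 + k q.2) p :=
    ((hf' _ hp.1).comp p contDiffAt_fst).add ((hk' _ hp.2).comp p contDiffAt_snd)
  have hf₂ := differentiableAt_fderiv (hf' _ hp.1)
  have hk₂ := differentiableAt_fderiv (hk' _ hp.2)
  refine ContinuousLinearMap.ext fun v => ContinuousLinearMap.ext fun w => ?_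
  have h₂ : fderiv ℝ (fderiv ℝ fun q : E × F => f q.1 + k q.2) p v w =
      fderiv ℝ (fderiv ℝ f) p.1 v.1 w.1 + fderiv ℝ (fderiv ℝ k) p.2 v.2 w.2 := by
    rw [fderiv_clm_eval (differentiableAt_fderiv hs), fderiv_clm_eval hf₂, fderiv_clm_eval hk₂]
    have h : (fun q => fderiv ℝ (fun q : E × F => f q.1 + k q.2) q w) =ᶠ[nhds p]
        fun q => fderiv ℝ f q.1 w.1 + fderiv ℝ k q.2 w.2 := by
      filter_upwards [(hG.isOpen.prod hK.isOpen).mem_nhds hp] with q hq using hd q hq w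
    rw [h.fderiv_eq]
    exact fderiv_add_prod (hf₂.clm_apply (differentiableAt_const _))
      (hk₂.clm_apply (differentiableAt_const _)) v
  rw [formProd_apply, localHessian_apply, localHessian_apply, localHessian_apply, h₂, hd p hp,
    christoffel_localProduct hG hK hp]
  ring

end LocalProduct

/-! ### Warped products with flat fibre on open sets -/

section LocalWarped

variable {E : Type*} [NormedAddCommGroup E] [NormedSpace ℝ E]
  {F : Type*} [NormedAddCommGroup F] [NormedSpace ℝ F]

/-- The metric `G + f² h` on `E × F`, where `h` is a constant form on `F`. -/
def localWarped (G : E → E →L[ℝ] E →L[ℝ] ℝ) (f : E → ℝ) (h : F →L[ℝ] F →L[ℝ] ℝ) :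
    E × F → (E × F) →L[ℝ] (E × F) →L[ℝ] ℝ :=
  fun p => formProd (G p.1) (f p.1 ^ 2 • h)

variable {G : E → E →L[ℝ] E →L[ℝ] ℝ} {U : Set E} {f : E → ℝ} {h : F →L[ℝ] F →L[ℝ] ℝ}
  {p : E × F}

/-- The data of a warped product over an open set: a metric, a nonvanishing smooth function, and a
nondegenerate symmetric form on the fibre. -/
structure IsWarpingData (G : E → E →L[ℝ] E →L[ℝ] ℝ) (U : Set E) (f : E → ℝ)
    (h : F →L[ℝ] F →L[ℝ] ℝ) : Prop where
  metric : IsMetricOn G U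
  contDiffAt : ∀ x ∈ U, ContDiffAt ℝ ∞ f x
  ne_zero : ∀ x ∈ U, f x ≠ 0
  fiber_symm : ∀ a b, h a b = h b a
  fiber_invertible : h.IsInvertible

namespace IsWarpingData

lemma differentiableAt {x : E} (W : IsWarpingData G U f h) (hx : x ∈ U) : DifferentiableAt ℝ f x :=
  (W.contDiffAt x hx).differentiableAt (by simp)

/-- The derivative of the components of the covector field `df / f`, by which the connection of a
warped product acts on the fibre. -/
lemma hasFDerivAt_logDeriv {x : E} (W : IsWarpingData G U f h) (hx : x ∈ U) (v : E) :
    HasFDerivAt (fun y => (f y)⁻¹ * fderiv ℝ f y v)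
      ((f x)⁻¹ • (fderiv ℝ (fderiv ℝ f) x).flip v
        - (fderiv ℝ f x v * ((f x) ^ 2)⁻¹) • fderiv ℝ f x) x := by
  have h₁ := (hasDerivAt_inv (W.ne_zero x hx)).comp_hasFDerivAt x
    (W.differentiableAt hx).hasFDerivAt
  have h₂ : HasFDerivAt (fun y => fderiv ℝ f y v) _ x :=
    (differentiableAt_fderiv (W.contDiffAt x hx)).hasFDerivAt.clm_apply (hasFDerivAt_const v x)
  refine (h₁.mul h₂).congr_fderiv ?_
  ext u
  simp
  ring

variable [FiniteDimensional ℝ E] [FiniteDimensional ℝ F]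

lemma isMetricOn (W : IsWarpingData G U f h) :
    IsMetricOn (localWarped G f h) (U ×ˢ (Set.univ : Set F)) where
  isOpen := W.metric.isOpen.prod isOpen_univ
  smooth := fun p hp => by
    have h₁ : ContDiffAt ℝ ∞ (fun q : E × F => f q.1) p :=
      (W.contDiffAt _ hp.1).comp p contDiffAt_fst
    exact (contDiffAt_formProd ((W.metric.contDiffAt hp.1).comp p contDiffAt_fst)
      ((h₁.pow 2).smul (contDiffAt_const (c := h)))).contDiffWithinAt
  symm := fun p hp v w => by
    simp [localWarped, formProd_apply, W.metric.symm p.1 hp.1 v.1, W.fiber_symm v.2]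
  invertible := fun p hp => formProd_isInvertible (W.metric.invertible _ hp.1)
    (isInvertible_smul W.fiber_invertible (pow_ne_zero 2 (W.ne_zero _ hp.1)))

lemma fderiv_localWarped (W : IsWarpingData G U f h) (hp : p.1 ∈ U) (u v w : E × F) :
    fderiv ℝ (localWarped G f h) p u v w =
      fderiv ℝ G p.1 u.1 v.1 w.1 + 2 * f p.1 * fderiv ℝ f p.1 u.1 * h v.2 w.2 := by
  have h₁ := W.metric.differentiableAt hp
  have h₂ : HasFDerivAt (fun x => f x ^ 2 • h) _ p.1 :=
    ((W.differentiableAt hp).hasFDerivAt.pow 2).smul_const h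
  have h₃ : DifferentiableAt ℝ (fun q : E × F => f q.1 ^ 2 • h) p :=
    h₂.differentiableAt.comp p differentiableAt_fst
  have := fderiv_formProd (h₁.comp p differentiableAt_fst) h₃ u
  have h₄ := congrArg (fun L : (E × F) →L[ℝ] (E × F) →L[ℝ] ℝ => L v w) this
  refine h₄.trans ?_
  rw [formProd_apply, fderiv_comp_fst (φ := fun x => f x ^ 2 • h) h₂.differentiableAt, h₂.fderiv]
  congr 1
  · exact congrArg (fun L : E →L[ℝ] E →L[ℝ] ℝ => L v.1 w.1) (fderiv_comp_fst h₁ u)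
  · simp

/-- The Levi-Civita connection of a warped product with flat fibre. -/
lemma christoffel_localWarped (W : IsWarpingData G U f h) (hp : p.1 ∈ U) (v w : E × F) :
    christoffel (localWarped G f h) p v w =
      (christoffel G p.1 v.1 w.1 - h v.2 w.2 • f p.1 • localGradient G f p.1,
        ((f p.1)⁻¹ * fderiv ℝ f p.1 v.1) • w.2 + ((f p.1)⁻¹ * fderiv ℝ f p.1 w.1) • v.2) := by
  refine W.isMetricOn.christoffel_eq ⟨hp, trivial⟩ fun u => ?_
  have hf := W.ne_zero _ hp
  simp only [localWarped, formProd_apply, map_sub, sub_apply,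
    map_smul, smul_apply, map_add, add_apply,
    smul_eq_mul, W.metric.apply_christoffel hp, W.metric.apply_localGradient hp]
  change _ = 2⁻¹ * (fderiv ℝ (localWarped G f h) p v w u + fderiv ℝ (localWarped G f h) p w v u -
    fderiv ℝ (localWarped G f h) p u v w)
  simp only [W.fderiv_localWarped hp]
  field_simp
  ring

lemma fderiv_christoffel_localWarped (W : IsWarpingData G U f h) (hp : p.1 ∈ U) (u v w : E × F) :
    fderiv ℝ (fun q => christoffel (localWarped G f h) q v w) p u =
      (fderiv ℝ (fun y => christoffel G y v.1 w.1) p.1 u.1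
          - h v.2 w.2 • (fderiv ℝ f p.1 u.1 • localGradient G f p.1
            + f p.1 • fderiv ℝ (localGradient G f) p.1 u.1),
        fderiv ℝ (fun y => (f y)⁻¹ * fderiv ℝ f y v.1) p.1 u.1 • w.2
          + fderiv ℝ (fun y => (f y)⁻¹ * fderiv ℝ f y w.1) p.1 u.1 • v.2) := by
  have hev : (fun q => christoffel (localWarped G f h) q v w) =ᶠ[nhds p]
      fun q => (christoffel G q.1 v.1 w.1 - h v.2 w.2 • f q.1 • localGradient G f q.1,
        ((f q.1)⁻¹ * fderiv ℝ f q.1 v.1) • w.2 + ((f q.1)⁻¹ * fderiv ℝ f q.1 w.1) • v.2) := by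
    filter_upwards [continuous_fst.continuousAt.preimage_mem_nhds
      (W.metric.isOpen.mem_nhds hp)] with q hq
    exact W.christoffel_localWarped hq v w
  have hN : HasFDerivAt (localGradient G f) _ p.1 :=
    ((W.metric.contDiffAt_localGradient hp (W.contDiffAt _ hp)).differentiableAt
      (by simp)).hasFDerivAt
  have h₁ : HasFDerivAt
      (fun y => christoffel G y v.1 w.1 - h v.2 w.2 • f y • localGradient G f y) _ p.1 :=
    (W.metric.differentiableAt_christoffel_apply hp v.1 w.1).hasFDerivAt.sub
      (((W.differentiableAt hp).hasFDerivAt.smul hN).const_smul (h v.2 w.2))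
  have h₂ : HasFDerivAt
      (fun y => ((f y)⁻¹ * fderiv ℝ f y v.1) • w.2 + ((f y)⁻¹ * fderiv ℝ f y w.1) • v.2) _ p.1 :=
    ((W.hasFDerivAt_logDeriv hp v.1).smul_const w.2).add
      ((W.hasFDerivAt_logDeriv hp w.1).smul_const v.2)
  rw [hev.fderiv_eq]
  refine (fderiv_prodMk_apply (h₁.differentiableAt.comp p differentiableAt_fst)
    (h₂.differentiableAt.comp p differentiableAt_fst) u).trans ?_
  refine Prod.ext ?_ ?_
  · refine (fderiv_comp_fst h₁.differentiableAt u).trans ?_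
    rw [h₁.fderiv]
    simp [add_comm]
  · refine (fderiv_comp_fst h₂.differentiableAt u).trans ?_
    rw [h₂.fderiv, (W.hasFDerivAt_logDeriv hp v.1).fderiv, (W.hasFDerivAt_logDeriv hp w.1).fderiv]
    rfl

/-- The diagonal block of the curvature of a warped product along the base. For the field
`S = f grad f`, the derivative `∇_u S` has a term `df(u) grad f`; it cancels against the term
`(df(u) / f) S` coming from the fibre, and only the Hessian is left. -/
lemma curvatureEnd_base (W : IsWarpingData G U f h) (hp : p.1 ∈ U) (u : E) (v w : E × F) :
    (curvatureEnd (localWarped G f h) p v w (u, 0)).1 =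
      curvatureEnd G p.1 v.1 w.1 u
        - (h v.2 w.2 * f p.1) • (G p.1).inverse (localHessian G f p.1 u) := by
  have hf := W.ne_zero _ hp
  rw [W.isMetricOn.curvatureEnd_apply ⟨hp, trivial⟩, W.metric.curvatureEnd_apply hp,
    ← W.metric.covariantDeriv_gradient hp (W.contDiffAt _ hp)]
  simp only [W.fderiv_christoffel_localWarped hp, W.christoffel_localWarped hp]
  simp only [Prod.fst_add, Prod.fst_sub, map_zero, zero_apply,
    zero_smul, smul_zero, sub_zero, add_zero, map_sub, map_smul, smul_eq_mul]
  match_scalars <;> field_simp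
  ring

/-- The diagonal block of the curvature of a warped product along the flat fibre. -/
lemma curvatureEnd_fiber (W : IsWarpingData G U f h) (hp : p.1 ∈ U) (c : F) (v w : E × F) :
    (curvatureEnd (localWarped G f h) p v w (0, c)).2 =
      -((f p.1)⁻¹ * localHessian G f p.1 v.1 w.1
          + h v.2 w.2 * fderiv ℝ f p.1 (localGradient G f p.1)) • c
        + (fderiv ℝ f p.1 (localGradient G f p.1) * h c w.2) • v.2 := by
  have hf := W.ne_zero _ hp
  rw [W.isMetricOn.curvatureEnd_apply ⟨hp, trivial⟩, localHessian_apply]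
  simp only [W.fderiv_christoffel_localWarped hp, W.christoffel_localWarped hp,
    (W.hasFDerivAt_logDeriv hp _).fderiv]
  simp
  match_scalars <;> field_simp
  ring

/-- The Ricci tensor of a warped product with flat fibre `(F, h)`, of dimension `d`:
`Ric = Ric_G - (d / f) Hess f` along the base, `-(f Δf + (d - 1) |∇f|²) h` along the fibre, and the
mixed components vanish. -/
lemma localRicci_localWarped (W : IsWarpingData G U f h) (hp : p.1 ∈ U) :
    localRicci (localWarped G f h) p =
      formProd (localRicci G p.1 - ((Module.finrank ℝ F : ℝ) / f p.1) • localHessian G f p.1)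
        (-(f p.1 * traceWith (G p.1) (localHessian G f p.1)
          + ((Module.finrank ℝ F : ℝ) - 1) * fderiv ℝ f p.1 (localGradient G f p.1)) • h) := by
  refine ContinuousLinearMap.ext fun v => ContinuousLinearMap.ext fun w => ?_
  set ν := fderiv ℝ f p.1 (localGradient G f p.1)
  have h₁ : LinearMap.fst ℝ E F ∘ₗ (curvatureEnd (localWarped G f h) p v w).toLinearMap ∘ₗ
      LinearMap.inl ℝ E F = (curvatureEnd G p.1 v.1 w.1).toLinearMap
        - (h v.2 w.2 * f p.1) • ((G p.1).inverse.comp (localHessian G f p.1)).toLinearMap :=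
    LinearMap.ext fun u => W.curvatureEnd_base hp u v w
  have h₂ : LinearMap.snd ℝ E F ∘ₗ (curvatureEnd (localWarped G f h) p v w).toLinearMap ∘ₗ
      LinearMap.inr ℝ E F =
        -((f p.1)⁻¹ * localHessian G f p.1 v.1 w.1 + h v.2 w.2 * ν) • LinearMap.id
        + (ν • (h.flip w.2).toLinearMap).smulRight v.2 :=
    LinearMap.ext fun c => W.curvatureEnd_fiber hp c v w
  rw [localRicci_apply, trace_prod_eq, h₁, h₂, map_sub, map_smul, map_add, map_smul,
    LinearMap.trace_id, LinearMap.trace_smulRight, formProd_apply, sub_apply, sub_apply,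
    localRicci_apply]
  simp only [smul_apply, LinearMap.smul_apply, smul_eq_mul, traceWith]
  -- the rank one part `c ↦ ν h(c, b) a` of the fibre block turns the factor `d` into `d - 1`
  change _ - _ + (_ + ν * h v.2 w.2) = _
  ring

end IsWarpingData

end LocalWarped

/-! ### Metrics of products in charts -/

section Charts

variable {E : Type*} [NormedAddCommGroup E] [NormedSpace ℝ E]
  {H : Type*} [TopologicalSpace H] {I : ModelWithCorners ℝ E H}
  {E' : Type*} [NormedAddCommGroup E'] [NormedSpace ℝ E']
  {H' : Type*} [TopologicalSpace H'] {I' : ModelWithCorners ℝ E' H'}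
  {M : Type*} [TopologicalSpace M] [ChartedSpace H M]
  {M' : Type*} [TopologicalSpace M'] [ChartedSpace H' M']

lemma mdifferentiableAt_extChartAt_symm [I.Boundaryless] [IsManifold I ∞ M] {p : M} {e : E}
    (he : e ∈ (extChartAt I p).target) :
    MDifferentiableAt 𝓘(ℝ, E) I (extChartAt I p).symm e := by
  have : IsManifold I 1 M := IsManifold.of_le (n := ∞) (by simp)
  have h := mdifferentiableWithinAt_extChartAt_symm he
  rwa [I.range_eq_univ, mdifferentiableWithinAt_univ] at h

/-- In the chart at `p`, a tensor field has at the centre of the chart the components it has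
at `p`. -/
lemma inChart_self [I.Boundaryless] [IsManifold I ∞ M] (b : Tensor₂ I M) (p : M) :
    inChart I b p (extChartAt I p p) = b p := by
  have : IsManifold I 1 M := IsManifold.of_le (n := ∞) (by simp)
  have h : mfderiv 𝓘(ℝ, E) I (extChartAt I p).symm (extChartAt I p p) =
      ContinuousLinearMap.id ℝ E := by
    have := mfderivWithin_range_extChartAt_symm (I := I) (x := p)
    rwa [I.range_eq_univ, mfderivWithin_univ] at this
  have hb : (b ((extChartAt I p).symm (extChartAt I p p)) : E →L[ℝ] E →L[ℝ] ℝ) = b p := by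
    rw [extChartAt_to_inv]
  refine ContinuousLinearMap.ext fun v => ContinuousLinearMap.ext fun w => ?_
  change (b ((extChartAt I p).symm (extChartAt I p p)) : E →L[ℝ] E →L[ℝ] ℝ)
    (mfderiv 𝓘(ℝ, E) I (extChartAt I p).symm (extChartAt I p p) v)
    (mfderiv 𝓘(ℝ, E) I (extChartAt I p).symm (extChartAt I p p) w) = b p v w
  rw [hb, h]
  rfl

lemma IsSemiRiemannian.isInvertible [FiniteDimensional ℝ E] {g : Tensor₂ I M}
    (hg : IsSemiRiemannian I g) (p : M) :
    ContinuousLinearMap.IsInvertible (g p : E →L[ℝ] E →L[ℝ] ℝ) :=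
  isInvertible_of_nondegenerate (E := E) (hg.nondegenerate p)

/-- A semi-Riemannian metric read in a chart is a metric on the target of the chart. -/
lemma IsSemiRiemannian.isMetricOn [FiniteDimensional ℝ E] [I.Boundaryless] [IsManifold I ∞ M]
    {g : Tensor₂ I M} (hg : IsSemiRiemannian I g) (p : M) :
    IsMetricOn (inChart I g p) (extChartAt I p).target where
  isOpen := isOpen_extChartAt_target p
  smooth := hg.smooth p
  symm := fun e _ v w => hg.symm ((extChartAt I p).symm e)
    (mfderiv 𝓘(ℝ, E) I (extChartAt I p).symm e v) (mfderiv 𝓘(ℝ, E) I (extChartAt I p).symm e w)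
  invertible := fun e he => by
    have : IsManifold I 1 M := IsManifold.of_le (n := ∞) (by simp)
    have h := isInvertible_mfderivWithin_extChartAt_symm he
    rw [I.range_eq_univ, mfderivWithin_univ] at h
    exact isInvertible_pullbackForm (E := E) (F := E)
      (hg.isInvertible ((extChartAt I p).symm e)) h

/-- A smooth function read in a chart is smooth. -/
lemma contDiffOn_comp_extChartAt_symm [IsManifold I ∞ M] {f : M → ℝ}
    (hf : ContMDiff I 𝓘(ℝ, ℝ) ∞ f) (p : M) :
    ContDiffOn ℝ ∞ (f ∘ (extChartAt I p).symm) (extChartAt I p).target :=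
  contMDiffOn_iff_contDiffOn.1 (hf.comp_contMDiffOn (contMDiffOn_extChartAt_symm p))

lemma mfderiv_eq_fderiv_extChartAt [I.Boundaryless] {f : M → ℝ}
    (hf : ContMDiff I 𝓘(ℝ, ℝ) ∞ f) (p : M) :
    (mfderiv I 𝓘(ℝ, ℝ) f p : E →L[ℝ] ℝ) =
      fderiv ℝ (f ∘ (extChartAt I p).symm) (extChartAt I p p) := by
  rw [((hf p).mdifferentiableAt (by simp)).mfderiv, I.range_eq_univ, fderivWithin_univ]
  rfl

/-- The gradient of a function is computed in the chart. -/
lemma gradient_eq_localGradient [I.Boundaryless] [IsManifold I ∞ M] (g : Tensor₂ I M) {f : M → ℝ}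
    (hf : ContMDiff I 𝓘(ℝ, ℝ) ∞ f) (p : M) :
    gradient I g f p =
      localGradient (inChart I g p) (f ∘ (extChartAt I p).symm) (extChartAt I p p) := by
  rw [localGradient, inChart_self, ← mfderiv_eq_fderiv_extChartAt hf]
  rfl

/-- `|∇f|² = df(grad f)`, computed in the chart. -/
lemma gradNormSq_eq [FiniteDimensional ℝ E] [I.Boundaryless] [IsManifold I ∞ M] {g : Tensor₂ I M}
    (hg : IsSemiRiemannian I g) {f : M → ℝ} (hf : ContMDiff I 𝓘(ℝ, ℝ) ∞ f) (p : M) :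
    gradNormSq I g f p = fderiv ℝ (f ∘ (extChartAt I p).symm) (extChartAt I p p)
      (localGradient (inChart I g p) (f ∘ (extChartAt I p).symm) (extChartAt I p p)) := by
  rw [← (hg.isMetricOn p).apply_localGradient (mem_extChartAt_target p), inChart_self,
    ← gradient_eq_localGradient g hf]
  rfl

lemma laplacian_eq [I.Boundaryless] [IsManifold I ∞ M] (g : Tensor₂ I M) (f : M → ℝ) (p : M) :
    laplacian I g f p = traceWith (inChart I g p (extChartAt I p p))
      (localHessian (inChart I g p) (f ∘ (extChartAt I p).symm) (extChartAt I p p)) := by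
  rw [inChart_self]
  rfl

lemma pullback_fst (g : Tensor₂ I M) (p : M × M') :
    (pullback (I.prod I') I Prod.fst g p : (E × E') →L[ℝ] (E × E') →L[ℝ] ℝ) =
      pullbackForm (E := E × E') (E' := E) (g p.1) (ContinuousLinearMap.fst ℝ E E') := by
  rw [pullback, mfderiv_fst]
  rfl

lemma pullback_snd (g' : Tensor₂ I' M') (p : M × M') :
    (pullback (I.prod I') I' Prod.snd g' p : (E × E') →L[ℝ] (E × E') →L[ℝ] ℝ) =
      pullbackForm (E := E × E') (E' := E') (g' p.2) (ContinuousLinearMap.snd ℝ E E') := by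
  rw [pullback, mfderiv_snd]
  rfl

lemma pullback_add_pullback (g : Tensor₂ I M) (g' : Tensor₂ I' M') (p : M × M') :
    ((pullback (I.prod I') I Prod.fst g + pullback (I.prod I') I' Prod.snd g' :
        Tensor₂ (I.prod I') (M × M')) p : (E × E') →L[ℝ] (E × E') →L[ℝ] ℝ) =
      formProd (E := E) (F := E') (g p.1) (g' p.2) := by
  rw [Pi.add_apply, pullback_fst, pullback_snd]
  rfl

lemma productMetric_apply (g : Tensor₂ I M) (g' : Tensor₂ I' M') (p : M × M') :
    (productMetric I I' g g' p : (E × E') →L[ℝ] (E × E') →L[ℝ] ℝ) =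
      formProd (E := E) (F := E') (g p.1) (g' p.2) :=
  pullback_add_pullback g g' p

lemma warpedMetric_apply (g : Tensor₂ I M) (g' : Tensor₂ I' M') (f : M → ℝ) (p : M × M') :
    (warpedMetric I I' g g' f p : (E × E') →L[ℝ] (E × E') →L[ℝ] ℝ) =
      formProd (E := E) (F := E') (g p.1) (f p.1 ^ 2 • g' p.2) := by
  rw [warpedMetric, pullback_fst, pullback_snd]
  rfl

/-- The derivative of the inverse of a product chart. -/
lemma mfderiv_extChartAt_prod_symm [I.Boundaryless] [IsManifold I ∞ M]
    [I'.Boundaryless] [IsManifold I' ∞ M'] {p : M × M'} {e : E × E'}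
    (he : e ∈ (extChartAt (I.prod I') p).target) :
    (mfderiv 𝓘(ℝ, E × E') (I.prod I') (extChartAt (I.prod I') p).symm e :
        (E × E') →L[ℝ] (E × E')) =
      ContinuousLinearMap.prodMap
        (mfderiv 𝓘(ℝ, E) I (extChartAt I p.1).symm e.1 : E →L[ℝ] E)
        (mfderiv 𝓘(ℝ, E') I' (extChartAt I' p.2).symm e.2 : E' →L[ℝ] E') := by
  rw [extChartAt_prod] at he ⊢
  have h₁ := (mdifferentiableAt_extChartAt_symm he.1).hasMFDerivAt
  have h₂ := (mdifferentiableAt_extChartAt_symm he.2).hasMFDerivAt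
  have h := h₁.prodMap (p := e) h₂
  rw [modelWithCornersSelf_prod, ← chartedSpaceSelf_prod]
  exact h.mfderiv

lemma inChart_productMetric [I.Boundaryless] [IsManifold I ∞ M]
    [I'.Boundaryless] [IsManifold I' ∞ M'] (g : Tensor₂ I M) (g' : Tensor₂ I' M') {p : M × M'}
    {e : E × E'} (he : e ∈ (extChartAt (I.prod I') p).target) :
    inChart (I.prod I') (productMetric I I' g g') p e =
      localProduct (inChart I g p.1) (inChart I' g' p.2) e := by
  rw [inChart, pullback, productMetric_apply, mfderiv_extChartAt_prod_symm he, extChartAt_prod]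
  rfl

lemma inChart_warpedMetric [I.Boundaryless] [IsManifold I ∞ M]
    [I'.Boundaryless] [IsManifold I' ∞ M'] (g : Tensor₂ I M) (g' : Tensor₂ I' M') (f : M → ℝ)
    {p : M × M'} {e : E × E'} (he : e ∈ (extChartAt (I.prod I') p).target) :
    inChart (I.prod I') (warpedMetric I I' g g' f) p e =
      formProd (inChart I g p.1 e.1)
        (f ((extChartAt I p.1).symm e.1) ^ 2 • inChart I' g' p.2 e.2) := by
  rw [inChart, pullback, warpedMetric_apply, mfderiv_extChartAt_prod_symm he, extChartAt_prod]
  rfl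

lemma inChart_productMetric_eventuallyEq [I.Boundaryless] [IsManifold I ∞ M]
    [I'.Boundaryless] [IsManifold I' ∞ M'] (g : Tensor₂ I M) (g' : Tensor₂ I' M') (p : M × M') :
    inChart (I.prod I') (productMetric I I' g g') p =ᶠ[nhds (extChartAt (I.prod I') p p)]
      localProduct (inChart I g p.1) (inChart I' g' p.2) := by
  filter_upwards [extChartAt_target_mem_nhds (I := I.prod I') p] with e he
  exact inChart_productMetric g g' he

lemma metricTrace_productMetric [FiniteDimensional ℝ E] [FiniteDimensional ℝ E'] {g : Tensor₂ I M}
    {g' : Tensor₂ I' M'} (hg : IsSemiRiemannian I g) (hg' : IsSemiRiemannian I' g')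
    {b : Tensor₂ (I.prod I') (M × M')} {c : Tensor₂ I M} {c' : Tensor₂ I' M'} {p : M × M'}
    (hb : b p = formProd (E := E) (F := E') (c p.1) (c' p.2)) :
    metricTrace (I.prod I') (productMetric I I' g g') b p =
      metricTrace I g c p.1 + metricTrace I' g' c' p.2 := by
  rw [metricTrace, productMetric_apply, hb]
  exact traceWith_formProd (hg.isInvertible p.1) (hg'.isInvertible p.2)

lemma contMDiff_warping {f : M → ℝ} (hf : ContMDiff I 𝓘(ℝ, ℝ) ∞ f) {f' : M' → ℝ}
    (hf' : ContMDiff I' 𝓘(ℝ, ℝ) ∞ f') :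
    ContMDiff (I.prod I') 𝓘(ℝ, ℝ) ∞ (warping f f') :=
  (hf.comp contMDiff_fst).add (hf'.comp contMDiff_snd)

lemma totalMetric_apply (g : Tensor₂ I M) (g' : Tensor₂ I' M') (f : M → ℝ) (f' : M' → ℝ) {d : ℕ}
    (p : (M × M') × EuclideanSpace ℝ (Fin d)) :
    totalMetric I I' g g' f f' d p =
      formProd (E := E × E') (F := EuclideanSpace ℝ (Fin d))
        (formProd (E := E) (F := E') (g p.1.1) (g' p.1.2))
        (warping f f' p.1 ^ 2 • negEuclidean d p.2) := by
  rw [totalMetric, warpedMetric_apply, productMetric_apply]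

/-- The trace of a block equation `Ric - c Hess f = λ g`. -/
lemma scalarCurvature_sub_laplacian [FiniteDimensional ℝ E] {g : Tensor₂ I M} {f : M → ℝ} {lam : ℝ}
    (hg : IsSemiRiemannian I g) {x : M} {c : ℝ}
    (h : ricci I g x - c • hessian I g f x = lam • g x) :
    scalarCurvature I g x - c * laplacian I g f x = lam * Module.finrank ℝ E := by
  have h₁ : traceWith (E := E) (g x) (ricci I g x - c • hessian I g f x) =
      traceWith (E := E) (g x) (lam • g x) := congrArg (traceWith (E := E) (g x)) h
  have h₂ : traceWith (E := E) (g x) (ricci I g x - c • hessian I g f x) =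
      scalarCurvature I g x - c * laplacian I g f x :=
    (traceWith_sub _ _ _).trans (congrArg _ (traceWith_smul _ _ _))
  have h₃ : traceWith (E := E) (g x) (lam • g x) = lam * Module.finrank ℝ E :=
    (traceWith_smul _ _ _).trans (congrArg _ (traceWith_self (hg.isInvertible x)))
  rw [← h₂, h₁, h₃]

end Charts

/-! ### Curvature of products and of warped products with flat fibre -/

section Curvature

variable {E : Type*} [NormedAddCommGroup E] [NormedSpace ℝ E] [FiniteDimensional ℝ E]
  {H : Type*} [TopologicalSpace H] {I : ModelWithCorners ℝ E H} [I.Boundaryless]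
  {E' : Type*} [NormedAddCommGroup E'] [NormedSpace ℝ E'] [FiniteDimensional ℝ E']
  {H' : Type*} [TopologicalSpace H'] {I' : ModelWithCorners ℝ E' H'} [I'.Boundaryless]
  {M : Type*} [TopologicalSpace M] [ChartedSpace H M] [IsManifold I ∞ M]
  {M' : Type*} [TopologicalSpace M'] [ChartedSpace H' M'] [IsManifold I' ∞ M']
  {g : Tensor₂ I M} {g' : Tensor₂ I' M'}

lemma IsSemiRiemannian.productMetric (hg : IsSemiRiemannian I g) (hg' : IsSemiRiemannian I' g') :
    IsSemiRiemannian (I.prod I') (productMetric I I' g g') where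
  symm := fun p v w => by
    rw [productMetric_apply]
    exact congrArg₂ (· + ·) (hg.symm p.1 v.1 w.1) (hg'.symm p.2 v.2 w.2)
  nondegenerate := fun p v hv => by
    rw [productMetric_apply] at hv
    exact (injective_iff_map_eq_zero _).1 (formProd_isInvertible (E := E) (F := E')
      (hg.isInvertible p.1) (hg'.isInvertible p.2)).injective v (ContinuousLinearMap.ext hv)
  smooth := fun p => by
    have h := ((hg.isMetricOn p.1).localProduct (hg'.isMetricOn p.2)).smooth
    refine ContDiffOn.congr ?_ fun e he => inChart_productMetric g g' he
    rwa [extChartAt_prod]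

/-- The Ricci tensor of a product is block diagonal, with the Ricci tensors of the factors. -/
lemma ricci_productMetric (hg : IsSemiRiemannian I g) (hg' : IsSemiRiemannian I' g') (p : M × M') :
    ricci (I.prod I') (productMetric I I' g g') p =
      formProd (E := E) (F := E') (ricci I g p.1) (ricci I' g' p.2) := by
  refine (localRicci_congr (inChart_productMetric_eventuallyEq g g' p)).trans ?_
  rw [extChartAt_prod]
  exact localRicci_localProduct (hg.isMetricOn p.1) (hg'.isMetricOn p.2)
    ⟨mem_extChartAt_target p.1, mem_extChartAt_target p.2⟩

/-- The Hessian of a sum of functions on the two factors of a product. -/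
lemma hessian_productMetric (hg : IsSemiRiemannian I g) (hg' : IsSemiRiemannian I' g')
    {f : M → ℝ} (hf : ContMDiff I 𝓘(ℝ, ℝ) ∞ f) {f' : M' → ℝ} (hf' : ContMDiff I' 𝓘(ℝ, ℝ) ∞ f')
    (p : M × M') :
    hessian (I.prod I') (productMetric I I' g g') (warping f f') p =
      formProd (E := E) (F := E') (hessian I g f p.1) (hessian I' g' f' p.2) := by
  refine (localHessian_congr (inChart_productMetric_eventuallyEq g g' p) _).trans ?_
  rw [extChartAt_prod]
  exact localHessian_localProduct (hg.isMetricOn p.1) (hg'.isMetricOn p.2)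
    ⟨mem_extChartAt_target p.1, mem_extChartAt_target p.2⟩
    (contDiffOn_comp_extChartAt_symm hf p.1) (contDiffOn_comp_extChartAt_symm hf' p.2)

lemma negEuclidean_isInvertible (d : ℕ) (z : EuclideanSpace ℝ (Fin d)) :
    ContinuousLinearMap.IsInvertible (negEuclidean d z :
      EuclideanSpace ℝ (Fin d) →L[ℝ] EuclideanSpace ℝ (Fin d) →L[ℝ] ℝ) := by
  refine isInvertible_of_nondegenerate (E := EuclideanSpace ℝ (Fin d)) fun v hv => ?_
  have h : -inner ℝ v v = 0 := hv v
  exact inner_self_eq_zero.1 (neg_eq_zero.1 h)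

lemma inChart_negEuclidean (d : ℕ) (z e : EuclideanSpace ℝ (Fin d)) :
    inChart 𝓘(ℝ, EuclideanSpace ℝ (Fin d)) (negEuclidean d) z e = negEuclidean d z := by
  rw [inChart, pullback, extChartAt_model_space_eq_id, PartialEquiv.refl_symm]
  have h : mfderiv 𝓘(ℝ, EuclideanSpace ℝ (Fin d)) 𝓘(ℝ, EuclideanSpace ℝ (Fin d))
      (PartialEquiv.refl (EuclideanSpace ℝ (Fin d))) e = ContinuousLinearMap.id ℝ _ := mfderiv_id
  rw [h]
  rfl

lemma ricci_negEuclidean (d : ℕ) :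
    ricci 𝓘(ℝ, EuclideanSpace ℝ (Fin d)) (negEuclidean d) = 0 := by
  funext z
  have h : inChart 𝓘(ℝ, EuclideanSpace ℝ (Fin d)) (negEuclidean d) z =
      fun _ => negEuclidean d z := funext fun e => inChart_negEuclidean d z e
  rw [ricci, h]
  exact localRicci_const _

/-- The Ricci tensor of the warped product `M ×_f ℝ^d` with fibre metric `-δ`. -/
lemma ricci_warpedMetric_negEuclidean (hg : IsSemiRiemannian I g) {f : M → ℝ}
    (hf : ContMDiff I 𝓘(ℝ, ℝ) ∞ f) (hf₀ : ∀ x, f x ≠ 0) (d : ℕ)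
    (p : M × EuclideanSpace ℝ (Fin d)) :
    ricci (I.prod 𝓘(ℝ, EuclideanSpace ℝ (Fin d)))
        (warpedMetric I 𝓘(ℝ, EuclideanSpace ℝ (Fin d)) g (negEuclidean d) f) p =
      formProd (E := E) (F := EuclideanSpace ℝ (Fin d))
        (ricci I g p.1 - ((d : ℝ) / f p.1) • hessian I g f p.1)
        (-(f p.1 * laplacian I g f p.1 + ((d : ℝ) - 1) * gradNormSq I g f p.1) •
          negEuclidean d p.2) := by
  have W : IsWarpingData (inChart I g p.1) (extChartAt I p.1).target
      (f ∘ (extChartAt I p.1).symm) (F := EuclideanSpace ℝ (Fin d)) (negEuclidean d p.2) :=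
    { metric := hg.isMetricOn p.1
      contDiffAt := fun e he => (contDiffOn_comp_extChartAt_symm hf p.1).contDiffAt
        ((isOpen_extChartAt_target p.1).mem_nhds he)
      ne_zero := fun e _ => hf₀ _
      fiber_symm := fun a b => congrArg Neg.neg (real_inner_comm b a)
      fiber_invertible := negEuclidean_isInvertible d p.2 }
  have hev : inChart (I.prod 𝓘(ℝ, EuclideanSpace ℝ (Fin d)))
        (warpedMetric I 𝓘(ℝ, EuclideanSpace ℝ (Fin d)) g (negEuclidean d) f) p
      =ᶠ[nhds (extChartAt (I.prod 𝓘(ℝ, EuclideanSpace ℝ (Fin d))) p p)]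
      localWarped (inChart I g p.1) (f ∘ (extChartAt I p.1).symm) (negEuclidean d p.2) := by
    filter_upwards [extChartAt_target_mem_nhds (I := I.prod 𝓘(ℝ, EuclideanSpace ℝ (Fin d))) p]
      with e he
    rw [inChart_warpedMetric g (negEuclidean d) f he, inChart_negEuclidean]
    rfl
  refine (localRicci_congr hev).trans ?_
  rw [extChartAt_prod]
  refine (W.localRicci_localWarped (p := (extChartAt I p.1 p.1, p.2))
    (mem_extChartAt_target p.1)).trans ?_
  rw [laplacian_eq, gradNormSq_eq hg hf, finrank_euclideanSpace_fin]
  simp only [Function.comp_apply, extChartAt_to_inv]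
  rfl

end Curvature

/-! ### The special sequential warped product -/

section Sequential

variable {E₁ : Type*} [NormedAddCommGroup E₁] [NormedSpace ℝ E₁] [FiniteDimensional ℝ E₁]
  {H₁ : Type*} [TopologicalSpace H₁] {I₁ : ModelWithCorners ℝ E₁ H₁} [I₁.Boundaryless]
  {E₂ : Type*} [NormedAddCommGroup E₂] [NormedSpace ℝ E₂] [FiniteDimensional ℝ E₂]
  {H₂ : Type*} [TopologicalSpace H₂] {I₂ : ModelWithCorners ℝ E₂ H₂} [I₂.Boundaryless]
  {B₁ : Type*} [TopologicalSpace B₁] [ChartedSpace H₁ B₁] [IsManifold I₁ ∞ B₁]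
  {B₂ : Type*} [TopologicalSpace B₂] [ChartedSpace H₂ B₂] [IsManifold I₂ ∞ B₂]
  {g₁ : Tensor₂ I₁ B₁} {g₂ : Tensor₂ I₂ B₂} {f₁ : B₁ → ℝ} {f₂ : B₂ → ℝ} {d : ℕ} {lam : ℝ}

lemma laplacian_productMetric_warping (hg₁ : IsSemiRiemannian I₁ g₁) (hg₂ : IsSemiRiemannian I₂ g₂)
    (hf₁ : ContMDiff I₁ 𝓘(ℝ, ℝ) ∞ f₁) (hf₂ : ContMDiff I₂ 𝓘(ℝ, ℝ) ∞ f₂) (b : B₁ × B₂) :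
    laplacian (I₁.prod I₂) (productMetric I₁ I₂ g₁ g₂) (warping f₁ f₂) b =
      laplacian I₁ g₁ f₁ b.1 + laplacian I₂ g₂ f₂ b.2 :=
  metricTrace_productMetric hg₁ hg₂ (hessian_productMetric hg₁ hg₂ hf₁ hf₂ b)

/-- The three diagonal blocks of the Ricci tensor of `M`; all other components vanish. -/
lemma ricci_totalMetric (hg₁ : IsSemiRiemannian I₁ g₁) (hg₂ : IsSemiRiemannian I₂ g₂)
    (hf₁ : ContMDiff I₁ 𝓘(ℝ, ℝ) ∞ f₁) (hf₂ : ContMDiff I₂ 𝓘(ℝ, ℝ) ∞ f₂)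
    (hf : ∀ b, warping f₁ f₂ b ≠ 0) (p : (B₁ × B₂) × EuclideanSpace ℝ (Fin d)) :
    ricci (totalModel I₁ I₂ d) (totalMetric I₁ I₂ g₁ g₂ f₁ f₂ d) p =
      formProd (E := E₁ × E₂) (F := EuclideanSpace ℝ (Fin d))
        (formProd (E := E₁) (F := E₂)
          (ricci I₁ g₁ p.1.1 - ((d : ℝ) / warping f₁ f₂ p.1) • hessian I₁ g₁ f₁ p.1.1)
          (ricci I₂ g₂ p.1.2 - ((d : ℝ) / warping f₁ f₂ p.1) • hessian I₂ g₂ f₂ p.1.2))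
        (-(warping f₁ f₂ p.1 * (laplacian I₁ g₁ f₁ p.1.1 + laplacian I₂ g₂ f₂ p.1.2)
            + ((d : ℝ) - 1) *
              gradNormSq (I₁.prod I₂) (productMetric I₁ I₂ g₁ g₂) (warping f₁ f₂) p.1) •
          negEuclidean d p.2) := by
  refine (ricci_warpedMetric_negEuclidean (hg₁.productMetric hg₂) (contMDiff_warping hf₁ hf₂) hf d
    p).trans ?_
  rw [laplacian_productMetric_warping hg₁ hg₂ hf₁ hf₂, ricci_productMetric hg₁ hg₂,
    hessian_productMetric hg₁ hg₂ hf₁ hf₂]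
  exact congrArg (fun b => formProd (E := E₁ × E₂) (F := EuclideanSpace ℝ (Fin d)) b _)
    (formProd_sub_smul_formProd (E := E₁) (F := E₂) _ _ _ _ _)

lemma negEuclidean_ne_zero (hd : 1 ≤ d) (z : EuclideanSpace ℝ (Fin d)) : negEuclidean d z ≠ 0 := by
  intro h
  have h₁ := DFunLike.congr_fun (DFunLike.congr_fun h (EuclideanSpace.single ⟨0, hd⟩ (1 : ℝ)))
    (EuclideanSpace.single ⟨0, hd⟩ (1 : ℝ))
  have h₂ : -inner ℝ (EuclideanSpace.single (⟨0, hd⟩ : Fin d) (1 : ℝ))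
      (EuclideanSpace.single ⟨0, hd⟩ (1 : ℝ)) = 0 := h₁
  simp at h₂

/-- The Einstein equation of `M`, block by block. -/
lemma isEinstein_totalMetric_iff (hg₁ : IsSemiRiemannian I₁ g₁) (hg₂ : IsSemiRiemannian I₂ g₂)
    (hf₁ : ContMDiff I₁ 𝓘(ℝ, ℝ) ∞ f₁) (hf₂ : ContMDiff I₂ 𝓘(ℝ, ℝ) ∞ f₂)
    (hf : ∀ b, warping f₁ f₂ b ≠ 0) (hd : 1 ≤ d) :
    IsEinstein (totalModel I₁ I₂ d) (totalMetric I₁ I₂ g₁ g₂ f₁ f₂ d) lam ↔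
      ∀ b : B₁ × B₂,
        ricci I₁ g₁ b.1 - ((d : ℝ) / warping f₁ f₂ b) • hessian I₁ g₁ f₁ b.1 = lam • g₁ b.1 ∧
        ricci I₂ g₂ b.2 - ((d : ℝ) / warping f₁ f₂ b) • hessian I₂ g₂ f₂ b.2 = lam • g₂ b.2 ∧
        warping f₁ f₂ b * (laplacian I₁ g₁ f₁ b.1 + laplacian I₂ g₂ f₂ b.2)
          + ((d : ℝ) - 1) *
            gradNormSq (I₁.prod I₂) (productMetric I₁ I₂ g₁ g₂) (warping f₁ f₂) b
          + lam * warping f₁ f₂ b ^ 2 = 0 := by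
  have key (p : (B₁ × B₂) × EuclideanSpace ℝ (Fin d)) :
      ricci (totalModel I₁ I₂ d) (totalMetric I₁ I₂ g₁ g₂ f₁ f₂ d) p =
        lam • totalMetric I₁ I₂ g₁ g₂ f₁ f₂ d p ↔
      ricci I₁ g₁ p.1.1 - ((d : ℝ) / warping f₁ f₂ p.1) • hessian I₁ g₁ f₁ p.1.1 =
          lam • g₁ p.1.1 ∧
        ricci I₂ g₂ p.1.2 - ((d : ℝ) / warping f₁ f₂ p.1) • hessian I₂ g₂ f₂ p.1.2 =
          lam • g₂ p.1.2 ∧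
        warping f₁ f₂ p.1 * (laplacian I₁ g₁ f₁ p.1.1 + laplacian I₂ g₂ f₂ p.1.2)
          + ((d : ℝ) - 1) *
            gradNormSq (I₁.prod I₂) (productMetric I₁ I₂ g₁ g₂) (warping f₁ f₂) p.1
          + lam * warping f₁ f₂ p.1 ^ 2 = 0 := by
    rw [ricci_totalMetric hg₁ hg₂ hf₁ hf₂ hf, totalMetric_apply]
    refine (Eq.congr_right ((smul_formProd (E := E₁ × E₂) (F := EuclideanSpace ℝ (Fin d))
      _ _ _).trans (congrArg (fun b => formProd (E := E₁ × E₂) (F := EuclideanSpace ℝ (Fin d)) b _)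
        (smul_formProd (E := E₁) (F := E₂) _ _ _)))).trans ?_
    refine (formProd_inj (E := E₁ × E₂) (F := EuclideanSpace ℝ (Fin d))).trans
      ((and_congr_left' (formProd_inj (E := E₁) (F := E₂))).trans (and_assoc.trans ?_))
    refine and_congr Iff.rfl (and_congr Iff.rfl ?_)
    refine (smul_eq_smul_smul_iff (E := EuclideanSpace ℝ (Fin d))
      (negEuclidean_ne_zero hd p.2)).trans ?_
    constructor <;> intro h <;> linarith
  rw [IsEinstein, funext_iff]
  exact ⟨fun h b => (key (b, 0)).1 (h (b, 0)), fun h p => (key p).2 (h p.1)⟩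

/-- The scalar curvature of `M`. -/
lemma scalarCurvature_totalMetric (hg₁ : IsSemiRiemannian I₁ g₁) (hg₂ : IsSemiRiemannian I₂ g₂)
    (hf₁ : ContMDiff I₁ 𝓘(ℝ, ℝ) ∞ f₁) (hf₂ : ContMDiff I₂ 𝓘(ℝ, ℝ) ∞ f₂)
    (hf : ∀ b, warping f₁ f₂ b ≠ 0) (p : (B₁ × B₂) × EuclideanSpace ℝ (Fin d)) :
    scalarCurvature (totalModel I₁ I₂ d) (totalMetric I₁ I₂ g₁ g₂ f₁ f₂ d) p =
      (scalarCurvature I₁ g₁ p.1.1 - (d : ℝ) / warping f₁ f₂ p.1 * laplacian I₁ g₁ f₁ p.1.1)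
      + (scalarCurvature I₂ g₂ p.1.2 - (d : ℝ) / warping f₁ f₂ p.1 * laplacian I₂ g₂ f₂ p.1.2)
      + -(warping f₁ f₂ p.1 * (laplacian I₁ g₁ f₁ p.1.1 + laplacian I₂ g₂ f₂ p.1.2)
          + ((d : ℝ) - 1) *
            gradNormSq (I₁.prod I₂) (productMetric I₁ I₂ g₁ g₂) (warping f₁ f₂) p.1)
        / warping f₁ f₂ p.1 ^ 2 * d := by
  have hw := pow_ne_zero 2 (hf p.1)
  have hF := negEuclidean_isInvertible d p.2
  have hB := formProd_isInvertible (E := E₁) (F := E₂) (hg₁.isInvertible p.1.1)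
    (hg₂.isInvertible p.1.2)
  rw [scalarCurvature, metricTrace, ricci_totalMetric hg₁ hg₂ hf₁ hf₂ hf, totalMetric_apply]
  refine (traceWith_formProd (E := E₁ × E₂) (F := EuclideanSpace ℝ (Fin d)) hB
    (isInvertible_smul (E := EuclideanSpace ℝ (Fin d)) hF hw)).trans ?_
  refine congrArg₂ (· + ·) ((traceWith_formProd (E := E₁) (F := E₂) (hg₁.isInvertible p.1.1)
    (hg₂.isInvertible p.1.2)).trans (congrArg₂ (· + ·) ?_ ?_)) ?_
  · exact (traceWith_sub _ _ _).trans (congrArg _ (traceWith_smul _ _ _))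
  · exact (traceWith_sub _ _ _).trans (congrArg _ (traceWith_smul _ _ _))
  · refine (traceWith_smul_self (E := EuclideanSpace ℝ (Fin d)) hF hw _).trans ?_
    rw [finrank_euclideanSpace_fin]

lemma scalarCurvature_negEuclidean (d : ℕ) (z : EuclideanSpace ℝ (Fin d)) :
    scalarCurvature 𝓘(ℝ, EuclideanSpace ℝ (Fin d)) (negEuclidean d) z = 0 := by
  rw [scalarCurvature, metricTrace, ricci_negEuclidean]
  exact traceWith_zero _

/-- The traced system determines the scalar curvature of `M`, whether or not `M` is Einstein. -/
lemma TracedSystem.scalarCurvature_totalMetric (hg₁ : IsSemiRiemannian I₁ g₁)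
    (hg₂ : IsSemiRiemannian I₂ g₂) (hf₁ : ContMDiff I₁ 𝓘(ℝ, ℝ) ∞ f₁)
    (hf₂ : ContMDiff I₂ 𝓘(ℝ, ℝ) ∞ f₂) (hf : ∀ b, warping f₁ f₂ b ≠ 0)
    (h : TracedSystem I₁ I₂ g₁ g₂ f₁ f₂ d lam) (p : (B₁ × B₂) × EuclideanSpace ℝ (Fin d)) :
    scalarCurvature (totalModel I₁ I₂ d) (totalMetric I₁ I₂ g₁ g₂ f₁ f₂ d) p =
      lam * ((Module.finrank ℝ E₁ : ℝ) + (Module.finrank ℝ E₂ : ℝ) + (d : ℝ)) := by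
  obtain ⟨h₁, h₂, h₃, -, h₄⟩ := h
  have hw := hf p.1
  have e₁ : scalarCurvature I₁ g₁ p.1.1 -
      (d : ℝ) / warping f₁ f₂ p.1 * laplacian I₁ g₁ f₁ p.1.1 = lam * Module.finrank ℝ E₁ := by
    field_simp
    linarith [h₁ p.1]
  have e₂ : -(warping f₁ f₂ p.1 * (laplacian I₁ g₁ f₁ p.1.1 + 0)
      + ((d : ℝ) - 1) *
        gradNormSq (I₁.prod I₂) (productMetric I₁ I₂ g₁ g₂) (warping f₁ f₂) p.1)
        / warping f₁ f₂ p.1 ^ 2 = lam := by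
    rw [div_eq_iff (pow_ne_zero 2 hw)]
    linarith [h₄ p.1]
  rw [SemiRiem.scalarCurvature_totalMetric hg₁ hg₂ hf₁ hf₂ hf, h₂, h₃, e₁, e₂]
  ring

end Sequential

end SemiRiem

end

open SemiRiem in
theorem theorem1p1
    {E₁ : Type*} [NormedAddCommGroup E₁] [NormedSpace ℝ E₁] [FiniteDimensional ℝ E₁]
    {H₁ : Type*} [TopologicalSpace H₁] (I₁ : ModelWithCorners ℝ E₁ H₁) [I₁.Boundaryless]
    {E₂ : Type*} [NormedAddCommGroup E₂] [NormedSpace ℝ E₂] [FiniteDimensional ℝ E₂]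
    {H₂ : Type*} [TopologicalSpace H₂] (I₂ : ModelWithCorners ℝ E₂ H₂) [I₂.Boundaryless]
    {B₁ : Type*} [TopologicalSpace B₁] [ChartedSpace H₁ B₁] [IsManifold I₁ ∞ B₁] [Nonempty B₁]
    {B₂ : Type*} [TopologicalSpace B₂] [ChartedSpace H₂ B₂] [IsManifold I₂ ∞ B₂] [Nonempty B₂]
    (g₁ : Tensor₂ I₁ B₁) (hg₁ : IsSemiRiemannian I₁ g₁)
    (g₂ : Tensor₂ I₂ B₂) (hg₂ : IsSemiRiemannian I₂ g₂)
    (lam : ℝ) (hB₂ : IsEinstein I₂ g₂ lam)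
    (f₁ : B₁ → ℝ) (hf₁ : ContMDiff I₁ 𝓘(ℝ, ℝ) ∞ f₁) (hf₁_pos : ∀ x, 0 < f₁ x)
    (f₂ : B₂ → ℝ) (hf₂ : ContMDiff I₂ 𝓘(ℝ, ℝ) ∞ f₂) (hf₂_pos : ∀ y, 0 < f₂ y)
    (d : ℕ) (hd : 1 ≤ d) :
    -- the Einstein condition on `M`
    (IsEinstein (totalModel I₁ I₂ d) (totalMetric I₁ I₂ g₁ g₂ f₁ f₂ d) lam ↔
      (∀ b : B₁ × B₂, ricci I₁ g₁ b.1 - ((d : ℝ) / warping f₁ f₂ b) • hessian I₁ g₁ f₁ b.1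
        = lam • g₁ b.1) ∧
      (∀ y, hessian I₂ g₂ f₂ y = 0) ∧
      ricci I₂ g₂ = lam • g₂ ∧
      ricci 𝓘(ℝ, EuclideanSpace ℝ (Fin d)) (negEuclidean d) = 0 ∧
      FiberEquation I₁ I₂ g₁ g₂ f₁ f₂ d lam) ∧
    -- the Ricci tensor of the base
    ricci (I₁.prod I₂) (productMetric I₁ I₂ g₁ g₂) =
      pullback (I₁.prod I₂) I₁ Prod.fst (ricci I₁ g₁) +
        pullback (I₁.prod I₂) I₂ Prod.snd (ricci I₂ g₂) ∧
    (IsEinstein (totalModel I₁ I₂ d) (totalMetric I₁ I₂ g₁ g₂ f₁ f₂ d) lam →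
      ∀ b : B₁ × B₂, ricci (I₁.prod I₂) (productMetric I₁ I₂ g₁ g₂) b =
        lam • productMetric I₁ I₂ g₁ g₂ b +
          ((d : ℝ) / warping f₁ f₂ b) •
            pullback (I₁.prod I₂) I₁ Prod.fst (hessian I₁ g₁ f₁) b) ∧
    -- the traced equations
    (IsEinstein (totalModel I₁ I₂ d) (totalMetric I₁ I₂ g₁ g₂ f₁ f₂ d) lam →
      (∀ p, scalarCurvature (totalModel I₁ I₂ d) (totalMetric I₁ I₂ g₁ g₂ f₁ f₂ d) p
        = lam * ((Module.finrank ℝ E₁ : ℝ) + (Module.finrank ℝ E₂ : ℝ) + (d : ℝ))) ∧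
      TracedSystem I₁ I₂ g₁ g₂ f₁ f₂ d lam) ∧
    (TracedSystem I₁ I₂ g₁ g₂ f₁ f₂ d lam →
      ∀ p, scalarCurvature (totalModel I₁ I₂ d) (totalMetric I₁ I₂ g₁ g₂ f₁ f₂ d) p
        = lam * ((Module.finrank ℝ E₁ : ℝ) + (Module.finrank ℝ E₂ : ℝ) + (d : ℝ))) := by
  have hf (b : B₁ × B₂) : warping f₁ f₂ b ≠ 0 := (add_pos (hf₁_pos b.1) (hf₂_pos b.2)).ne'
  have hd₀ : (d : ℝ) ≠ 0 := by exact_mod_cast (Nat.one_le_iff_ne_zero.1 hd)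
  have hR₂ (y : B₂) : ricci I₂ g₂ y = lam • g₂ y := congrFun hB₂ y
  have hlap (H : ∀ y, hessian I₂ g₂ f₂ y = 0) (y : B₂) : laplacian I₂ g₂ f₂ y = 0 := by
    rw [laplacian, metricTrace, H y]
    exact traceWith_zero _
  have hA : IsEinstein (totalModel I₁ I₂ d) (totalMetric I₁ I₂ g₁ g₂ f₁ f₂ d) lam ↔
      (∀ b : B₁ × B₂, ricci I₁ g₁ b.1 - ((d : ℝ) / warping f₁ f₂ b) • hessian I₁ g₁ f₁ b.1
        = lam • g₁ b.1) ∧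
      (∀ y, hessian I₂ g₂ f₂ y = 0) ∧
      ricci I₂ g₂ = lam • g₂ ∧
      ricci 𝓘(ℝ, EuclideanSpace ℝ (Fin d)) (negEuclidean d) = 0 ∧
      FiberEquation I₁ I₂ g₁ g₂ f₁ f₂ d lam := by
    rw [isEinstein_totalMetric_iff hg₁ hg₂ hf₁ hf₂ hf hd]
    constructor
    · intro h
      have H (y : B₂) : hessian I₂ g₂ f₂ y = 0 := by
        -- as `B₂` is Einstein, its block of the equation reads `(d / f) Hess f₂ = 0`
        obtain ⟨x⟩ := ‹Nonempty B₁›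
        have h₂ := (h (x, y)).2.1
        rw [hR₂ y, sub_eq_self, smul_eq_zero] at h₂
        exact h₂.resolve_left (div_ne_zero hd₀ (hf _))
      refine ⟨fun b => (h b).1, H, hB₂, ricci_negEuclidean d, fun b => ?_⟩
      have h₃ := (h b).2.2
      rwa [hlap H, add_zero] at h₃
    · rintro ⟨h₁, H, -, -, h₃⟩ b
      refine ⟨h₁ b, ?_, ?_⟩
      · rw [H, smul_zero, sub_zero, hR₂]
      · rw [hlap H, add_zero]
        exact h₃ b
  have hTraced (h : IsEinstein (totalModel I₁ I₂ d) (totalMetric I₁ I₂ g₁ g₂ f₁ f₂ d) lam) :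
      TracedSystem I₁ I₂ g₁ g₂ f₁ f₂ d lam := by
    obtain ⟨h₁, H, -, -, h₃⟩ := hA.1 h
    refine ⟨fun b => ?_, hlap H, fun y => ?_, scalarCurvature_negEuclidean d, h₃⟩
    · have e := scalarCurvature_sub_laplacian hg₁ (h₁ b)
      have hw := hf b
      field_simp at e
      linarith
    · have e := scalarCurvature_sub_laplacian (f := f₂) (c := 0) hg₂
        (by rw [zero_smul, sub_zero, hR₂ y])
      rwa [zero_mul, sub_zero] at e
  refine ⟨hA, ?_, fun h b => ?_, fun h => ⟨?_, hTraced h⟩, fun h => ?_⟩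
  · funext b
    rw [ricci_productMetric hg₁ hg₂, pullback_add_pullback]
  · rw [ricci_productMetric hg₁ hg₂, productMetric_apply, pullback_fst, hR₂,
      eq_add_of_sub_eq ((hA.1 h).1 b)]
    exact formProd_smul_add (E := E₁) (F := E₂) _ _ _ _ _
  · exact (hTraced h).scalarCurvature_totalMetric hg₁ hg₂ hf₁ hf₂ hf
  · exact h.scalarCurvature_totalMetric hg₁ hg₂ hf₁ hf₂ hf
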